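/- Let $\mathsf Z$ be a Polish space, $V:\mathsf Z\to[1,\infty)$ measurable, and let $L_\infty^V$ be the set of measurable $g:\mathsf Z\to\mathbb R$ with $\|g\|_V:=\sup_z |g(z)|/V(z)<\infty$. Let $\mathbf\Phi=\{\Phi_n\}_{n\ge0}$ be a time-homogeneous Markov chain on $\mathsf Z$ with invariant probability measure $\pi$, and $f^*:\mathsf Z\to\mathbb R^d$ measurable. Put $\Delta_n=f^*(\Phi_n)$. Assume: (A1) $\mathbf\Phi$ is $V$-uniformly ergodic: there are $\rho\in(0,1)$ and $B_V<\infty$ with $\bigl|\mathsf E[g(\Phi_n)\mid\Phi_0=z]-\pi(g)\bigr|\le B_V\|g\|_V\,\rho^n V(z)$ for all $g\in L_\infty^V$, $z\in\mathsf Z$, $n\ge0$ (all these expectations being finite); (A2) $A\in\mathbb R^{d\times d}$ is Hurwitz and the step size is $\alpha_n=1/n$; (A3) $(f_i^*)^2\in L_\infty^V$ and $\pi(f_i^*)=0$ for each $i$; and moreover every eigenvalue $\lambda$ of $A$ satisfies $\mathrm{Re}(\lambda)<-1$. For fixed (deterministic) initial conditions $\Phi_0=z_0$ and $\tilde\theta_0=x_0$,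 let $\tilde\theta_{n+1}=\tilde\theta_n+\frac1{n+1}\,[A\tilde\theta_n+\Delta_{n+1}]$, $n\ge 0$, and $\mathrm{Cov}(\theta_n)=\mathsf E[\tilde\theta_n\tilde\theta_n^{\intercal}]$. Then the following hold; $\mathsf E_\pi$ denotes expectation for the stationary (two-sided) chain. 1. The series $\Sigma_\Delta=\sum_{k=-\infty}^\infty\mathsf E_\pi[\Delta_k\Delta_0^{\intercal}]$ converges. 2. There are unique $\hat f$ and $\hat{\hat f}$ with coordinates in $L_\infty^V$ and zero $\pi$-mean that solve the two Poisson equations $$\mathsf E[\hat f(\Phi_{k+1})\mid\Phi_k=z]=\hat f(z)-f^*(z),\qquad \mathsf E[\hat{\hat f}(\Phi_{k+1})\mid\Phi_k=z]=\hat{\hat f}(z)-\hat f(z)\qquad(z\in\mathsf Z),$$ and $\hat f_i^2,\hat{\hat f}_i^2\in L_\infty^V$ for each $i$. Put $Z_n=\hat f(\Phi_n)$, $\hat Z_n=\hat{\hat f}(\Phi_n)$, $\Delta^m_{n+1}=Z_{n+1}-\mathsf E[Z_{n+1}\mid\Phi_n]$, $\hat\Delta^m_{n+1}=\hat Z_{n+1}-\mathsf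 E[\hat Z_{n+1}\mid\Phi_n]$, $\Sigma_Z=\mathsf E_\pi[Z_nZ_n^{\intercal}]$, $\mathrm{Cov}_\pi(\hat\Delta^m_n,\Delta^m_n)=\mathsf E_\pi[\hat\Delta^m_n(\Delta^m_n)^{\intercal}]$, and $\mathrm{Cov}_\pi(\Delta^m_n,\hat\Delta^m_n)=\mathsf E_\pi[\Delta^m_n(\hat\Delta^m_n)^{\intercal}]$. 3. The Lyapunov equation $[\tfrac12I+A]\Sigma+\Sigma[\tfrac12I+A]^{\intercal}+\Sigma_\Delta=0$ has a unique solution $\Sigma_\theta$, which is positive semidefinite, and the equation $$[I+A]\,[\Sigma-\mathrm{Cov}_\pi(\hat\Delta^m_n,\Delta^m_n)]+[\Sigma-\mathrm{Cov}_\pi(\Delta^m_n,\hat\Delta^m_n)]\,[I+A]^{\intercal}+A\Sigma_\theta A^{\intercal}-\Sigma_\Delta=0$$ has a unique solution $\Sigma_\sharp$. 4. $\tilde\theta_n$ has finite second moments for every $n$, and there is $\delta>0$ that depends only on $A$ and $\Sigma_\Delta$ such that, as $n\to\infty$, $$\mathrm{Cov}(\theta_n)=n^{-1}\Sigma_\theta+n^{-2}\Sigma_{\theta,2}+O(n^{-2-\delta}),\qquad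 \Sigma_{\theta,2}=\Sigma_\sharp+\Sigma_Z-\mathsf E_\pi[\Delta^m_n\hat Z_n^{\intercal}]-\mathsf E_\pi[\hat Z_n(\Delta^m_n)^{\intercal}].$$ -/

import Mathlib

open MeasureTheory ProbabilityTheory Matrix

noncomputable section

namespace LinearSA

universe u v

variable {Z : Type u} [MeasurableSpace Z] {d : ℕ}

/-- The weighted supremum norm `‖g‖_V = sup_z |g z| / V z` (meaningful on `MemLV V`). -/
def normV (V : Z → ℝ) (g : Z → ℝ) : ℝ := ⨆ z, |g z| / V z

/-- Membership in `L_∞^V`: `g` is measurable and `‖g‖_V < ∞`. -/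
structure MemLV (V : Z → ℝ) (g : Z → ℝ) : Prop where
  measurable : Measurable g
  bddAbove : BddAbove (Set.range fun z => |g z| / V z)

/-- `V`-uniform ergodicity of the transition kernel `κ`, with invariant probability measure `π`:
`|E[g(Φ_n) | Φ_0 = z] - π(g)| ≤ B ‖g‖_V ρ^n V(z)` for all `g ∈ L_∞^V`, all `z` and all `n ≥ 0`.
The expectations are required to be genuine ones (`V` is integrable under `π` and under every
`P^n(z, ·)`). Uniqueness of the invariant probability measure follows from the bound. -/
structure IsVUniformlyErgodic (κ : Kernel Z Z) (π : Measure Z) (V : Z → ℝ) : Prop where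
  invariant : κ.Invariant π
  integrable_pow : ∀ (n : ℕ) (z : Z), Integrable V ((κ ^ n) z)
  integrable_inv : Integrable V π
  ergodic : ∃ ρ : ℝ, 0 < ρ ∧ ρ < 1 ∧ ∃ B : ℝ, ∀ g : Z → ℝ, MemLV V g → ∀ (z : Z) (n : ℕ),
    |(∫ y, g y ∂((κ ^ n) z)) - ∫ y, g y ∂π| ≤ B * normV V g * ρ ^ n * V z

/-- `Φ` is a time-homogeneous Markov chain with transition kernel `κ` and initial state `z₀`,
with respect to the filtration `ℱ`. -/
structure IsMarkovChain {Ω : Type v} {mΩ : MeasurableSpace Ω} (P : Measure Ω) [IsFiniteMeasure P]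
    (ℱ : Filtration ℕ mΩ)
    (κ : Kernel Z Z) (z₀ : Z) (Φ : ℕ → Ω → Z) : Prop where
  adapted : ∀ n, Measurable[ℱ n] (Φ n)
  initial : ∀ᵐ ω ∂P, Φ 0 ω = z₀
  markov : ∀ (n : ℕ) (s : Set Z), MeasurableSet s →
    P⟦Φ (n + 1) ⁻¹' s | ℱ n⟧ =ᵐ[P] fun ω => (κ (Φ n ω)).real s

/-- The linear stochastic approximation recursion for the error, with step size `1 / n`:
`θ_{n+1} = θ_n + (n+1)⁻¹ (A θ_n + Δ_{n+1})`, with `θ_0 = x₀` and noise sequence `Δ`. -/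
def linearSA (A : Matrix (Fin d) (Fin d) ℝ) (x₀ : Fin d → ℝ) (Δ : ℕ → Fin d → ℝ) :
    ℕ → Fin d → ℝ
  | 0 => x₀
  | n + 1 => linearSA A x₀ Δ n +
      (1 / ((n : ℝ) + 1)) • (A *ᵥ linearSA A x₀ Δ n + Δ (n + 1))

/-- `h` is a zero-mean solution in `L_∞^V` (in each coordinate) of Poisson's equation with
forcing function `g`: `E[h(Φ_{k+1}) | Φ_k = z] = h(z) - g(z)` for every `z`. -/
structure IsPoissonSolution (κ : Kernel Z Z) (π : Measure Z) (V : Z → ℝ)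
    (g h : Z → Fin d → ℝ) : Prop where
  memLV : ∀ i, MemLV V fun z => h z i
  mean_zero : ∀ i, ∫ z, h z i ∂π = 0
  poisson : ∀ z i, ∫ y, h y i ∂(κ z) = h z i - g z i

/-- The martingale difference `h(Φ_{n+1}) - E[h(Φ_{n+1}) | Φ_n]` as a function of the pair
`(Φ_n, Φ_{n+1})`. -/
def mdiff (κ : Kernel Z Z) (h : Z → Fin d → ℝ) (p : Z × Z) (i : Fin d) : ℝ :=
  h p.2 i - ∫ y, h y i ∂(κ p.1)

/-- `E_π[Δ_k Δ_0ᵀ]` for `Δ_n = f(Φ_n)`, `k ∈ ℤ`, under the two-sided stationary chain: the pair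
`(Φ_0, Φ_k)` has law `π ⊗ P^k` for `k ≥ 0`, and `(Φ_k, Φ_0)` has law `π ⊗ P^{-k}` for `k < 0`. -/
def autocov (κ : Kernel Z Z) (π : Measure Z) (f : Z → Fin d → ℝ) (k : ℤ) :
    Matrix (Fin d) (Fin d) ℝ :=
  Matrix.of fun i j =>
    if 0 ≤ k then ∫ p, f p.2 i * f p.1 j ∂(π ⊗ₘ (κ ^ k.toNat))
    else ∫ p, f p.1 i * f p.2 j ∂(π ⊗ₘ (κ ^ (-k).toNat))

/-- The asymptotic covariance of the noise, `Σ_Δ = ∑_{k ∈ ℤ} E_π[Δ_k Δ_0ᵀ]`. -/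
def noiseCov (κ : Kernel Z Z) (π : Measure Z) (f : Z → Fin d → ℝ) :
    Matrix (Fin d) (Fin d) ℝ :=
  Matrix.of fun i j => ∑' k : ℤ, autocov κ π f k i j

/-- The stationary covariance `E_π[h(Φ_n) h(Φ_n)ᵀ]`. -/
def statCov (π : Measure Z) (h : Z → Fin d → ℝ) : Matrix (Fin d) (Fin d) ℝ :=
  Matrix.of fun i j => ∫ z, h z i * h z j ∂π

/-- The stationary cross-covariance `E_π[G Hᵀ]` of two functions of `(Φ_{n-1}, Φ_n)`. -/
def crossCov (κ : Kernel Z Z) (π : Measure Z) (G H : Z × Z → Fin d → ℝ) :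
    Matrix (Fin d) (Fin d) ℝ :=
  Matrix.of fun i j => ∫ p, G p i * H p j ∂(π ⊗ₘ κ)

/-- The Lyapunov equation `[½I + A]S + S[½I + A]ᵀ + Q = 0`. -/
def IsLyapunov (A Q S : Matrix (Fin d) (Fin d) ℝ) : Prop :=
  ((1 / 2 : ℝ) • (1 : Matrix (Fin d) (Fin d) ℝ) + A) * S
    + S * ((1 / 2 : ℝ) • (1 : Matrix (Fin d) (Fin d) ℝ) + A)ᵀ + Q = 0

/-- The second Lyapunov equation
`[I + A][S - C] + [S - D][I + A]ᵀ + A Σ_θ Aᵀ - Q = 0`. -/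
def IsLyapunovTwo (A Q Sθ C D S : Matrix (Fin d) (Fin d) ℝ) : Prop :=
  (1 + A) * (S - C) + (S - D) * (1 + A)ᵀ + A * Sθ * Aᵀ - Q = 0

end LinearSA

end

open LinearSA

/-! The noise enters linearly, so second moments obey linear recursions. Put x = 1/(n+1), write P
for the kernel and m_n(k) = E[θ_n (Pᵏf)(Φ_n)ᵀ]. Conditioning on the past gives C_{n+1} = (1 + xA)
C_n (1 + xAᵀ) + x (1 + xA) m_n(1) + x m_n(1)ᵀ (1 + xAᵀ) + x² E[Δ_{n+1} Δ_{n+1}ᵀ] for the covariance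
C_n, and m_{n+1}(k) = (1 + xA) m_n(k+1) + x E[Δ_{n+1} (Pᵏf)(Φ_{n+1})ᵀ].

The second recursion does not close in k, but each step moves one lag further, and ergodicity makes
lag k cost rᵏ. In the norm weighted by r⁻ᵏ it therefore contracts, and the ansatz m_n(k) ≈ μ₁(k)/n +
μ₂(k)/n² holds up to O(n⁻³) (`lag_expansion`). Matching powers gives difference equations in k.
Their decaying solutions are sums over lags, hence expressions in the Poisson solutions f̂ = ∑ Pᵏf
and its iterate: μ₁(k) = E_π[f (Pᵏf̂)ᵀ] and, with f̂ replaced by its own Poisson solution and one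
more lag, μ₂(k) up to the factor 1 + A.

Insert this in the first recursion and try C_n ≈ Σ_θ/n + Σ₂/n². The coefficients of x² and x³ vanish
exactly when two Lyapunov equations hold; they are the stated ones once stationary cross-covariances
of martingale differences are rewritten through f, f̂ and P (`crossCov_vpoisson`). The remainder is
O(n⁻⁴), and stability of X ↦ (1 + xA) X (1 + xAᵀ) turns it into an error O(n^(-2p)) for some p > 1
(`bound_of_recursion`), so δ = 2p - 2. That stability comes from a norm adapted to A
(`exists_isAdaptedNorm`), which also yields unique solvability of the Lyapunov equations.

All second moments of functions of the chain must be finite with geometric decay. Since f² is O(V),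
f is only O(√V), and its Poisson solution must be O(√V) as well; this is why V-uniform ergodicity is
first upgraded to √V-uniform ergodicity (`exists_sqrt`). -/

noncomputable section

namespace LinearSA

open Filter Topology

/-! ### Adapted norms and stability of two-sided Euler recursions. -/

section AdaptedNorm

/-- A norm on a normed algebra, equivalent to the given one, for which the two-sided Euler steps
`X ↦ (1 + s A) X (1 + s A')` contract at rate `(1 - p s) ^ 2` for small `s`. -/
structure IsAdaptedNorm {R : Type*} [NormedRing R] [NormedAlgebra ℝ R] (A A' : R) (p h K : ℝ)
    (ν : R → ℝ) : Prop where
  le : ∀ X, ‖X‖ ≤ ν X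
  le_mul : ∀ X, ν X ≤ K * ‖X‖
  add_le : ∀ X Y, ν (X + Y) ≤ ν X + ν Y
  smul_le : ∀ (c : ℝ) X, 0 ≤ c → ν (c • X) ≤ c * ν X
  contract : ∀ (s : ℝ) X, 0 ≤ s → s ≤ h →
    ν ((1 + s • A) * X * (1 + s • A')) ≤ (1 - p * s) ^ 2 * ν X

variable {R : Type*} [NormedRing R] [NormedAlgebra ℝ R]

/-- With M = 1 + hA, M' = 1 + hA' and q = 1 - hp, the supremum over k, l of q^(-k-l) ‖Mᵏ X M'ˡ‖
shrinks by q under multiplication by M on the left or M' on the right, because this only shifts the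
index. For smaller s, 1 + sA is the convex combination of 1 and M with weight s/h, which gives the
factor 1 - ps on each side. -/
theorem exists_isAdaptedNorm {A A' : R} {p h C : ℝ} (hh : 0 < h) (hq : 0 < 1 - h * p)
    (hM : ∀ k : ℕ, ‖(1 + h • A) ^ k‖ ≤ C * (1 - h * p) ^ k)
    (hM' : ∀ k : ℕ, ‖(1 + h • A') ^ k‖ ≤ C * (1 - h * p) ^ k) :
    ∃ (K : ℝ) (ν : R → ℝ), 0 ≤ K ∧ IsAdaptedNorm A A' p h K ν := by
  set M := 1 + h • A with hMdef
  set M' := 1 + h • A' with hMdef'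
  set q := 1 - h * p with hqdef
  have hC : 0 ≤ C := by simpa using (norm_nonneg _).trans (hM 0)
  let w : R → ℕ × ℕ → ℝ := fun X kl => (q ^ kl.1 * q ^ kl.2)⁻¹ * ‖M ^ kl.1 * X * M' ^ kl.2‖
  have hw : ∀ X kl, w X kl ≤ C ^ 2 * ‖X‖ := by
    intro X ⟨k, l⟩
    have h1 : ‖M ^ k * X * M' ^ l‖ ≤ (C * q ^ k) * ‖X‖ * (C * q ^ l) :=
      (norm_mul_le _ _).trans (mul_le_mul ((norm_mul_le _ _).trans
        (mul_le_mul_of_nonneg_right (hM k) (norm_nonneg _))) (hM' l) (norm_nonneg _)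
        (by positivity))
    calc w X (k, l) ≤ (q ^ k * q ^ l)⁻¹ * ((C * q ^ k) * ‖X‖ * (C * q ^ l)) :=
          mul_le_mul_of_nonneg_left h1 (by positivity)
      _ = C ^ 2 * ‖X‖ := by field_simp
  have hbdd : ∀ X, BddAbove (Set.range (w X)) := fun X =>
    ⟨C ^ 2 * ‖X‖, by rintro _ ⟨kl, rfl⟩; exact hw X kl⟩
  let ν : R → ℝ := fun X => ⨆ kl, w X kl
  have hle : ∀ X kl, w X kl ≤ ν X := fun X kl => le_ciSup (hbdd X) kl
  have hadd : ∀ X Y, ν (X + Y) ≤ ν X + ν Y := by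
    intro X Y
    refine ciSup_le fun kl => ?_
    refine le_trans ?_ (add_le_add (hle X kl) (hle Y kl))
    simp only [w, mul_add, add_mul]
    rw [← mul_add]
    exact mul_le_mul_of_nonneg_left (norm_add_le _ _) (by positivity)
  have hsmul : ∀ (c : ℝ) X, 0 ≤ c → ν (c • X) ≤ c * ν X := by
    intro c X hc
    refine ciSup_le fun kl => ?_
    refine le_trans (le_of_eq ?_) (mul_le_mul_of_nonneg_left (hle X kl) hc)
    simp only [w, mul_smul_comm, smul_mul_assoc, norm_smul, Real.norm_eq_abs, abs_of_nonneg hc]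
    ring
  have hleft : ∀ X, ν (M * X) ≤ q * ν X := by
    intro X
    refine ciSup_le fun ⟨k, l⟩ => ?_
    refine le_trans (le_of_eq ?_) (mul_le_mul_of_nonneg_left (hle X (k + 1, l)) hq.le)
    simp only [w, pow_succ, mul_assoc]
    field_simp
  have hright : ∀ X, ν (X * M') ≤ q * ν X := by
    intro X
    refine ciSup_le fun ⟨k, l⟩ => ?_
    refine le_trans (le_of_eq ?_) (mul_le_mul_of_nonneg_left (hle X (k, l + 1)) hq.le)
    simp only [w, pow_succ' M', pow_succ q, mul_assoc]
    field_simp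
  have hnn : ∀ X, 0 ≤ ν X := fun X =>
    le_trans (by simp only [w]; positivity) (hle X (0, 0))
  refine ⟨C ^ 2, ν, by positivity, ⟨fun X => ?_, fun X => ciSup_le (hw X), hadd, hsmul, ?_⟩⟩
  · simpa [w] using hle X (0, 0)
  intro s X hs0 hsh
  have ht0 : 0 ≤ s / h := by positivity
  have ht1 : 0 ≤ 1 - s / h := by rw [sub_nonneg, div_le_one hh]; exact hsh
  have hl : ∀ X, ν ((1 + s • A) * X) ≤ (1 - p * s) * ν X := by
    intro X
    have e : (1 + s • A) * X = (1 - s / h) • X + (s / h) • (M * X) := by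
      rw [hMdef, add_mul, add_mul, smul_add, smul_mul_assoc, smul_mul_assoc, smul_smul,
        div_mul_cancel₀ _ hh.ne', sub_smul, one_smul, one_mul]
      abel
    rw [e]
    refine (hadd _ _).trans ((add_le_add (hsmul _ _ ht1) ((hsmul _ _ ht0).trans
      (mul_le_mul_of_nonneg_left (hleft X) ht0))).trans (le_of_eq ?_))
    rw [hqdef]; field_simp; ring
  have hr : ∀ X, ν (X * (1 + s • A')) ≤ (1 - p * s) * ν X := by
    intro X
    have e : X * (1 + s • A') = (1 - s / h) • X + (s / h) • (X * M') := by
      rw [hMdef', mul_add, mul_add, smul_add, mul_smul_comm, mul_smul_comm, smul_smul,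
        div_mul_cancel₀ _ hh.ne', sub_smul, one_smul, mul_one]
      abel
    rw [e]
    refine (hadd _ _).trans ((add_le_add (hsmul _ _ ht1) ((hsmul _ _ ht0).trans
      (mul_le_mul_of_nonneg_left (hright X) ht0))).trans (le_of_eq ?_))
    rw [hqdef]; field_simp; ring
  have hp : 0 ≤ 1 - p * s := by
    have : 1 - p * s = (1 - s / h) + (s / h) * q := by rw [hqdef]; field_simp; ring
    rw [this]; positivity
  calc _ ≤ (1 - p * s) * ν ((1 + s • A) * X) := hr _
    _ ≤ (1 - p * s) * ((1 - p * s) * ν X) := mul_le_mul_of_nonneg_left (hl X) hp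
    _ = _ := by ring

variable {A A' : R} {p h K : ℝ} {ν : R → ℝ}

theorem IsAdaptedNorm.nonneg (hν : IsAdaptedNorm A A' p h K ν) (X : R) : 0 ≤ ν X :=
  (norm_nonneg X).trans (hν.le X)

/-- If `A X + X A' = - c X` with `c < 2 p`, then `X = 0`. -/
theorem IsAdaptedNorm.eq_zero_of_mul_add_mul (hν : IsAdaptedNorm A A' p h K ν) (hh : 0 < h)
    {c : ℝ} (hc : c < 2 * p) {X : R} (hX : A * X + X * A' = -(c • X)) : X = 0 := by
  -- One Euler step multiplies X by 1 - cs up to a term of order s², but it contracts by (1 - ps)².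
  -- Comparing, dividing by s and letting s → 0 forces (2p - c) ν X ≤ 0.
  have key : ∀ s : ℝ, 0 < s → s ≤ h →
      (2 * p - c) * ν X ≤ s * (p ^ 2 * ν X + ν (-(A * X * A'))) := by
    intro s hs hsh
    have e : (1 - c * s) • X = (1 + s • A) * X * (1 + s • A') + (s ^ 2) • (-(A * X * A')) := by
      have : (1 + s • A) * X * (1 + s • A')
          = X + s • (A * X + X * A') + (s ^ 2) • (A * X * A') := by
        simp only [add_mul, mul_add, one_mul, mul_one, smul_mul_assoc, mul_smul_comm]
        module
      rw [this, hX]; module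
    by_cases hcs : c * s ≤ 1
    · have h1 : (1 - c * s) * ν X ≤ (1 - p * s) ^ 2 * ν X + s ^ 2 * ν (-(A * X * A')) := by
        have h2 : ν ((1 - c * s) • X) ≤ (1 - p * s) ^ 2 * ν X + s ^ 2 * ν (-(A * X * A')) := by
          rw [e]
          exact (hν.add_le _ _).trans (add_le_add (hν.contract s X hs.le hsh)
            (hν.smul_le _ _ (by positivity)))
        refine le_trans ?_ h2
        rcases eq_or_lt_of_le (sub_nonneg.2 hcs) with h0 | h0
        · rw [← h0]; simpa using hν.nonneg _
        · have := hν.smul_le (1 - c * s)⁻¹ ((1 - c * s) • X) (by positivity)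
          rw [smul_smul, inv_mul_cancel₀ h0.ne', one_smul] at this
          calc (1 - c * s) * ν X ≤ (1 - c * s) * ((1 - c * s)⁻¹ * ν ((1 - c * s) • X)) :=
                mul_le_mul_of_nonneg_left this h0.le
            _ = _ := by field_simp
      refine le_of_mul_le_mul_left ?_ hs
      nlinarith
    -- Here cs > 1, so `smul_le` is not available for 1 - cs; but then (1 - ps)² ≥ 0 already gives
    -- 2p - c ≤ s p².
    · have h3 : 0 ≤ ν X := hν.nonneg X
      have h4 : 0 ≤ ν (-(A * X * A')) := hν.nonneg _
      have h5 : 2 * p - c ≤ s * p ^ 2 := by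
        refine le_of_mul_le_mul_left ?_ hs
        nlinarith [sq_nonneg (1 - p * s)]
      nlinarith [mul_le_mul_of_nonneg_right h5 h3]
  have hlim : Tendsto (fun s : ℝ => s * (p ^ 2 * ν X + ν (-(A * X * A')))) (𝓝[>] 0) (𝓝 0) := by
    have : Tendsto (fun s : ℝ => s * (p ^ 2 * ν X + ν (-(A * X * A')))) (𝓝 0) (𝓝 (0 * _)) :=
      tendsto_id.mul_const _
    rw [zero_mul] at this
    exact this.mono_left nhdsWithin_le_nhds
  have h0 : (2 * p - c) * ν X ≤ 0 := by
    refine ge_of_tendsto hlim ?_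
    filter_upwards [Ioc_mem_nhdsGT hh] with s hs using key s hs.1 hs.2
  have h1 : ν X ≤ 0 := by
    by_contra hpos
    push Not at hpos
    nlinarith
  exact norm_le_zero_iff.1 ((hν.le X).trans h1)

/-- Stability of the two-sided recursion `E_{n+1} = (1 + A/(n+1)) E_n (1 + A'/(n+1)) + R_n`. -/
theorem IsAdaptedNorm.bound_of_recursion (hν : IsAdaptedNorm A A' p h K ν) (hK : 0 ≤ K)
    (hh : 0 < h) (hp : 1 ≤ p) {p' : ℝ} (hp' : p' ≤ p) {E Rm : ℕ → R} {c : ℝ}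
    (hE : ∀ n : ℕ, 1 ≤ n → E (n + 1) =
      (1 + (1 / ((n : ℝ) + 1)) • A) * E n * (1 + (1 / ((n : ℝ) + 1)) • A') + Rm n)
    (hR : ∀ n : ℕ, 1 ≤ n → ‖Rm n‖ ≤ c * ((n : ℝ) + 1) ^ (-(2 * p' + 3 / 2))) :
    ∃ L : ℝ, ∀ n : ℕ, 1 ≤ n → ‖E n‖ ≤ L * (n : ℝ) ^ (-(2 * p')) := by
  -- From n₀ on the step size is at most h and 1 - p/(n+1) is nonnegative.
  obtain ⟨n₀, hn₀⟩ := exists_nat_ge (max (1 / h) p)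
  have hn1 : 1 ≤ n₀ := by
    have : (1 : ℝ) ≤ n₀ := hp.trans ((le_max_right _ _).trans hn₀)
    exact_mod_cast this
  -- The claim is that u is bounded: its increments turn out to be at most a summable sequence of
  -- order n^(-3/2).
  set u : ℕ → ℝ := fun n => (n : ℝ) ^ (2 * p') * ν (E n) with hu
  have hc : 0 ≤ c := by
    have := (norm_nonneg _).trans (hR 1 le_rfl)
    exact nonneg_of_mul_nonneg_left this (by positivity)
  have hstep : ∀ n : ℕ, n₀ ≤ n → u (n + 1) ≤ u n + K * c * ((n : ℝ) + 1) ^ (-(3 / 2 : ℝ)) := by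
    intro n hn
    have hnpos : (1 : ℝ) ≤ n := by exact_mod_cast hn1.trans hn
    have hnn : (n₀ : ℝ) ≤ n := by exact_mod_cast hn
    set N : ℝ := (n : ℝ) + 1 with hN
    have hN0 : 0 < N := by positivity
    have hs : 1 / N ≤ h := by
      rw [div_le_comm₀ hN0 hh]
      linarith [le_max_left (1 / h) p]
    have hpN : p ≤ N := by linarith [le_max_right (1 / h) p]
    have h0 : 0 ≤ 1 - p * (1 / N) := by
      rw [mul_one_div, sub_nonneg, div_le_one hN0]; exact hpN
    -- Bernoulli's inequality: the contraction factor is dominated by the ratio of the weights at n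
    -- and n + 1.
    have hb : 1 - p * (1 / N) ≤ ((n : ℝ) / N) ^ p' := by
      have hx : (n : ℝ) / N = 1 + -(1 / N) := by rw [hN]; field_simp; ring
      have h1 : 1 / N ≤ 1 := by rw [div_le_one hN0]; linarith
      have hxpos : 0 < (n : ℝ) / N := by positivity
      calc 1 - p * (1 / N) = 1 + p * (-(1 / N)) := by ring
        _ ≤ (1 + -(1 / N)) ^ p := one_add_mul_self_le_rpow_one_add (by linarith) hp
        _ = ((n : ℝ) / N) ^ p := by rw [hx]
        _ ≤ ((n : ℝ) / N) ^ p' := Real.rpow_le_rpow_of_exponent_ge hxpos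
            (by rw [div_le_one hN0]; linarith) hp'
    have hb2 : (1 - p * (1 / N)) ^ 2 ≤ (n : ℝ) ^ (2 * p') / N ^ (2 * p') := by
      calc (1 - p * (1 / N)) ^ 2 ≤ (((n : ℝ) / N) ^ p') ^ 2 := pow_le_pow_left₀ h0 hb 2
        _ = ((n : ℝ) / N) ^ (2 * p') := by
            rw [← Real.rpow_natCast, ← Real.rpow_mul (by positivity)]; congr 1; push_cast; ring
        _ = _ := Real.div_rpow (by positivity) hN0.le _
    have hEν : ν (E (n + 1)) ≤ (n : ℝ) ^ (2 * p') / N ^ (2 * p') * ν (E n)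
        + K * (c * N ^ (-(2 * p' + 3 / 2))) := by
      rw [hE n (hn1.trans hn)]
      refine (hν.add_le _ _).trans (add_le_add ?_ ?_)
      · exact (hν.contract _ _ (by positivity) hs).trans
          (mul_le_mul_of_nonneg_right hb2 (hν.nonneg _))
      · exact (hν.le_mul _).trans (mul_le_mul_of_nonneg_left (hR n (hn1.trans hn)) hK)
    have hNp : 0 < N ^ (2 * p') := Real.rpow_pos_of_pos hN0 _
    calc u (n + 1) = N ^ (2 * p') * ν (E (n + 1)) := by simp only [hu, hN]; push_cast; rfl
      _ ≤ N ^ (2 * p') * ((n : ℝ) ^ (2 * p') / N ^ (2 * p') * ν (E n)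
        + K * (c * N ^ (-(2 * p' + 3 / 2)))) := mul_le_mul_of_nonneg_left hEν hNp.le
      _ = u n + K * c * (N ^ (2 * p') * N ^ (-(2 * p' + 3 / 2))) := by
          simp only [hu]; field_simp
      _ = _ := by rw [← Real.rpow_add hN0]; congr 3; ring
  have hsum : Summable fun n : ℕ => ((n : ℝ) + 1) ^ (-(3 / 2 : ℝ)) := by
    have := (summable_nat_add_iff (f := fun n : ℕ => (n : ℝ) ^ (-(3 / 2 : ℝ))) 1).2
      (Real.summable_nat_rpow.2 (by norm_num))
    simpa using this
  have hKc : 0 ≤ K * c := mul_nonneg hK hc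
  set T := ∑' n : ℕ, ((n : ℝ) + 1) ^ (-(3 / 2 : ℝ)) with hT
  have hle : ∀ n : ℕ, n₀ ≤ n →
      u n ≤ u n₀ + K * c * ∑ k ∈ Finset.range n, ((k : ℝ) + 1) ^ (-(3 / 2 : ℝ)) := by
    intro n hn
    induction n, hn using Nat.le_induction with
    | base =>
      have : 0 ≤ ∑ k ∈ Finset.range n₀, ((k : ℝ) + 1) ^ (-(3 / 2 : ℝ)) :=
        Finset.sum_nonneg fun k _ => by positivity
      nlinarith
    | succ n hn ih =>
      rw [Finset.sum_range_succ, mul_add]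
      linarith [hstep n hn]
  have hle' : ∀ n : ℕ, n₀ ≤ n → u n ≤ u n₀ + K * c * T := fun n hn =>
    (hle n hn).trans (by
      gcongr
      exact hsum.sum_le_tsum _ fun k _ => by positivity)
  have hun : ∀ n, 0 ≤ u n := fun n => mul_nonneg (by positivity) (hν.nonneg _)
  have hT0 : 0 ≤ T := tsum_nonneg fun n => by positivity
  -- The sum covers the finitely many indices below n₀.
  refine ⟨(∑ k ∈ Finset.range n₀, u k) + (u n₀ + K * c * T), fun n hn => ?_⟩
  have hn0 : (0 : ℝ) < n := by exact_mod_cast hn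
  have hb : u n ≤ (∑ k ∈ Finset.range n₀, u k) + (u n₀ + K * c * T) := by
    rcases lt_or_ge n n₀ with h | h
    · have := Finset.single_le_sum (f := u) (fun k _ => hun k) (Finset.mem_range.2 h)
      have : 0 ≤ K * c * T := by positivity
      linarith [hun n₀]
    · have : 0 ≤ ∑ k ∈ Finset.range n₀, u k := Finset.sum_nonneg fun k _ => hun k
      linarith [hle' n h]
  calc ‖E n‖ ≤ ν (E n) := hν.le _
    _ = u n * (n : ℝ) ^ (-(2 * p')) := by
      simp only [hu]
      rw [Real.rpow_neg hn0.le]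
      have := (Real.rpow_pos_of_pos hn0 (2 * p')).ne'
      field_simp
    _ ≤ _ := mul_le_mul_of_nonneg_right hb (by positivity)

end AdaptedNorm

/-! ### Adapted norms for matrices and Lyapunov equations. -/

section LyapunovTheory

attribute [local instance] Matrix.linftyOpNormedRing Matrix.linftyOpNormedAlgebra

/-- Gelfand's formula gives ‖aᵏ‖ ≤ qᵏ from some index on; the constant absorbs the earlier powers.
-/
theorem exists_norm_pow_le_of_spectralRadius_lt {R : Type*} [NormedRing R] [NormedAlgebra ℂ R]
    [CompleteSpace R] {a : R} {q : ℝ} (hq : 0 < q)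
    (ha : spectralRadius ℂ a < ENNReal.ofReal q) : ∃ C : ℝ, ∀ k : ℕ, ‖a ^ k‖ ≤ C * q ^ k := by
  have h := (spectrum.pow_norm_pow_one_div_tendsto_nhds_spectralRadius a).eventually_lt_const ha
  obtain ⟨n₀, hn₀⟩ := eventually_atTop.1 h
  have hnn : ∀ k, 0 ≤ ‖a ^ k‖ / q ^ k := fun k => by positivity
  refine ⟨1 + ∑ k ∈ Finset.range (n₀ + 1), ‖a ^ k‖ / q ^ k, fun k => ?_⟩
  rw [← div_le_iff₀ (by positivity)]
  rcases lt_or_ge k (n₀ + 1) with hk | hk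
  · have := Finset.single_le_sum (f := fun k => ‖a ^ k‖ / q ^ k) (fun k _ => hnn k)
      (Finset.mem_range.2 hk)
    linarith
  · have h1 : ‖a ^ k‖ ^ (1 / k : ℝ) < q :=
      (ENNReal.ofReal_lt_ofReal_iff hq).1 (hn₀ k (by omega))
    have hk0 : (k : ℝ) ≠ 0 := by
      have : k ≠ 0 := by omega
      exact_mod_cast this
    have h2 : ‖a ^ k‖ ≤ q ^ k := by
      have := pow_le_pow_left₀ (by positivity) h1.le k
      rwa [← Real.rpow_natCast, ← Real.rpow_mul (norm_nonneg _), one_div_mul_cancel hk0,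
        Real.rpow_one] at this
    have h3 : ‖a ^ k‖ / q ^ k ≤ 1 := (div_le_one (by positivity)).2 h2
    have := Finset.sum_nonneg (s := Finset.range (n₀ + 1)) fun k _ => hnn k
    linarith

variable {d : ℕ}

/-- The spectral argument takes place over ℂ; this brings its power bound back to the real matrix
with the same constant. -/
theorem norm_map_ofReal (X : Matrix (Fin d) (Fin d) ℝ) :
    ‖X.map (algebraMap ℝ ℂ)‖ = ‖X‖ := by
  simp [Matrix.linfty_opNorm_def]

theorem abs_apply_le_norm (X : Matrix (Fin d) (Fin d) ℝ) (i j : Fin d) : |X i j| ≤ ‖X‖ := by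
  have h1 : ‖X i j‖₊ ≤ ∑ j, ‖X i j‖₊ :=
    Finset.single_le_sum (f := fun j => ‖X i j‖₊) (fun _ _ => zero_le) (Finset.mem_univ j)
  have h2 : ∑ j, ‖X i j‖₊ ≤ Finset.univ.sup fun i => ∑ j, ‖X i j‖₊ :=
    Finset.le_sup (f := fun i => ∑ j, ‖X i j‖₊) (Finset.mem_univ i)
  rw [Matrix.linfty_opNorm_def]
  exact_mod_cast h1.trans h2

theorem norm_le_sum_abs (X : Matrix (Fin d) (Fin d) ℝ) : ‖X‖ ≤ ∑ i, ∑ j, |X i j| := by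
  have h : (Finset.univ.sup fun i => ∑ j, ‖X i j‖₊) ≤ ∑ i, ∑ j, ‖X i j‖₊ :=
    Finset.sup_le fun i hi =>
      Finset.single_le_sum (f := fun i => ∑ j, ‖X i j‖₊) (fun _ _ => zero_le) hi
  rw [Matrix.linfty_opNorm_def]
  exact (NNReal.coe_le_coe.2 h).trans (le_of_eq (by simp))

theorem norm_le_of_abs_apply_le {X : Matrix (Fin d) (Fin d) ℝ} {b : ℝ}
    (hX : ∀ i j, |X i j| ≤ b) : ‖X‖ ≤ (d : ℝ) ^ 2 * b := by
  refine (norm_le_sum_abs X).trans ((Finset.sum_le_sum fun i _ =>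
    Finset.sum_le_sum fun j _ => hX i j).trans (le_of_eq ?_))
  simp; ring

theorem norm_transpose_le (X : Matrix (Fin d) (Fin d) ℝ) : ‖Xᵀ‖ ≤ (d : ℝ) ^ 2 * ‖X‖ :=
  norm_le_of_abs_apply_le fun i j => abs_apply_le_norm X j i

/-- If all eigenvalues of `A` have real part `< -1`, then there is an adapted norm with rate
`p > 1`. -/
theorem exists_isAdaptedNorm_of_hasEigenvalue (A : Matrix (Fin d) (Fin d) ℝ)
    (hA : ∀ μ : ℂ, Module.End.HasEigenvalue
      (Matrix.toLin' (A.map (algebraMap ℝ ℂ))) μ → μ.re < -1) :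
    ∃ (p h K : ℝ) (ν : Matrix (Fin d) (Fin d) ℝ → ℝ), 1 < p ∧ p ≤ 5 / 4 ∧ 0 < h ∧ 0 ≤ K ∧
      IsAdaptedNorm A Aᵀ p h K ν := by
  set B := A.map (algebraMap ℝ ℂ) with hB
  have hspec : ∀ μ ∈ spectrum ℂ B, μ.re < -1 := fun μ hμ => hA μ <| by
    rw [Module.End.hasEigenvalue_iff_mem_spectrum, Matrix.spectrum_toLin']; exact hμ
  have hfin := Matrix.finite_spectrum B
  -- The spectrum is finite, so there is room for p between 1 and all -Re μ. The cap 5/4 makes 2p +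
  -- 3/2 ≤ 4, so that a remainder of order n⁻⁴ is small enough for `bound_of_recursion`.
  obtain ⟨p, hp1, hp2, hpspec⟩ : ∃ p : ℝ, 1 < p ∧ p ≤ 5 / 4 ∧
      ∀ μ ∈ spectrum ℂ B, μ.re < -p := by
    have : ∀ᶠ p : ℝ in 𝓝[>] 1, ∀ μ ∈ spectrum ℂ B, μ.re < -p := by
      rw [eventually_all_finite hfin]
      intro μ hμ
      have : Tendsto (fun p : ℝ => -p) (𝓝[>] 1) (𝓝 (-1)) :=
        (continuous_neg.tendsto 1).mono_left nhdsWithin_le_nhds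
      exact this.eventually_const_lt (hspec μ hμ)
    obtain ⟨p, h1, h2⟩ := (this.and (Ioc_mem_nhdsGT (by norm_num : (1 : ℝ) < 5 / 4))).exists
    exact ⟨p, h2.1, h2.2, h1⟩
  -- To first order in h, |1 + hμ| is 1 + h Re μ, which is below 1 - hp; the quadratic term h²|μ|²
  -- is harmless for small h.
  obtain ⟨h, hh, hq, hhspec⟩ : ∃ h : ℝ, 0 < h ∧ 0 < 1 - h * p ∧
      ∀ μ ∈ spectrum ℂ B, ‖1 + (h : ℂ) * μ‖ < 1 - h * p := by
    have hcont : Tendsto (fun h : ℝ => 1 - h * p) (𝓝[>] 0) (𝓝 1) := by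
      have : Tendsto (fun h : ℝ => 1 - h * p) (𝓝 0) (𝓝 (1 - 0 * p)) :=
        (continuous_const.sub (continuous_id.mul continuous_const)).tendsto 0
      simpa using this.mono_left nhdsWithin_le_nhds
    have hev1 : ∀ᶠ h : ℝ in 𝓝[>] 0, 0 < 1 - h * p := hcont.eventually_const_lt one_pos
    have hev2 : ∀ᶠ h : ℝ in 𝓝[>] 0, ∀ μ ∈ spectrum ℂ B, ‖1 + (h : ℂ) * μ‖ < 1 - h * p := by
      rw [eventually_all_finite hfin]
      intro μ hμ
      have ht : Tendsto (fun h : ℝ => h * (μ.re ^ 2 + μ.im ^ 2)) (𝓝[>] 0) (𝓝 0) := by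
        have : Tendsto (fun h : ℝ => h * (μ.re ^ 2 + μ.im ^ 2)) (𝓝 0) (𝓝 (0 * _)) :=
          tendsto_id.mul_const _
        rw [zero_mul] at this
        exact this.mono_left nhdsWithin_le_nhds
      have hpos : 0 < 2 * (-μ.re - p) := by linarith [hpspec μ hμ]
      filter_upwards [hev1, ht.eventually_lt_const hpos, self_mem_nhdsWithin] with h h1 h2 h3
      refine lt_of_pow_lt_pow_left₀ 2 h1.le ?_
      rw [← Complex.normSq_eq_norm_sq, Complex.normSq_apply]
      have h3' : (0 : ℝ) < h := h3
      simp only [Complex.add_re, Complex.one_re, Complex.mul_re, Complex.ofReal_re,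
        Complex.ofReal_im, Complex.add_im, Complex.one_im, Complex.mul_im]
      nlinarith [mul_lt_mul_of_pos_left h2 h3', sq_nonneg (h * p)]
    obtain ⟨h, ⟨h1, h2⟩, h3⟩ := ((hev1.and hev2).and self_mem_nhdsWithin).exists
    exact ⟨h, h3, h1, h2⟩
  obtain ⟨C, hC⟩ : ∃ C : ℝ, ∀ k : ℕ,
      ‖(1 + h • A) ^ k‖ ≤ C * (1 - h * p) ^ k := by
    have hsr : spectralRadius ℂ (1 + (h : ℂ) • B) < ENNReal.ofReal (1 - h * p) := by
      -- The spectrum is empty when d = 0.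
      rcases (spectrum ℂ (1 + (h : ℂ) • B)).eq_empty_or_nonempty with he | hne
      · rw [spectralRadius, he]; simpa using hq
      · refine spectrum.spectralRadius_lt_of_forall_lt_of_nonempty hne (r := (1 - h * p).toNNReal)
          fun z hz => ?_
        have hz' : (z - 1) / h ∈ spectrum ℂ B := by
          rw [spectrum.mem_iff] at hz ⊢
          intro hu
          apply hz
          have hu0 : IsUnit (algebraMap ℂ (Matrix (Fin d) (Fin d) ℂ) (h : ℂ)) :=
            (IsUnit.mk0 (h : ℂ) (by exact_mod_cast hh.ne')).map _
          have := hu0.mul hu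
          convert this using 1
          have hhc : (h : ℂ) ≠ 0 := by exact_mod_cast hh.ne'
          rw [mul_sub, ← map_mul, mul_div_cancel₀ _ hhc, map_sub, map_one,
            Algebra.smul_def]
          abel
        have := hhspec _ hz'
        rw [mul_div_cancel₀ _ (by exact_mod_cast hh.ne' : (h : ℂ) ≠ 0)] at this
        rw [← NNReal.coe_lt_coe, Real.coe_toNNReal _ hq.le]
        simpa using this
    obtain ⟨C, hC⟩ := exists_norm_pow_le_of_spectralRadius_lt hq hsr
    refine ⟨C, fun k => ?_⟩
    have e : ((1 + h • A) ^ k).map (algebraMap ℝ ℂ) = (1 + (h : ℂ) • B) ^ k := by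
      have h1 : (1 + (h : ℂ) • B) = (algebraMap ℝ ℂ).mapMatrix (1 + h • A) := by
        ext i j
        simp [hB, Matrix.one_apply]
        split_ifs <;> simp
      rw [h1, ← map_pow]; rfl
    rw [← norm_map_ofReal, e]
    exact hC k
  set c : ℝ := (d : ℝ) ^ 2
  have hc0 : 0 ≤ c := by positivity
  have hC0 : 0 ≤ C := by
    have := (norm_nonneg _).trans (hC 0)
    simpa using this
  obtain ⟨K, ν, hK, hν⟩ := exists_isAdaptedNorm (A := A) (A' := Aᵀ) (C := max C (c * C)) hh hq
    (fun k => (hC k).trans (mul_le_mul_of_nonneg_right (le_max_left _ _) (by positivity)))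
    (fun k => by
      have : (1 + h • Aᵀ) ^ k = ((1 + h • A) ^ k)ᵀ := by simp [Matrix.transpose_pow]
      rw [this]
      refine (norm_transpose_le _).trans ((mul_le_mul_of_nonneg_left (hC k) hc0).trans ?_)
      rw [← mul_assoc]
      exact mul_le_mul_of_nonneg_right (le_max_right _ _) (by positivity))
  exact ⟨p, h, K, ν, hp1, hp2, hh, hK, hν⟩

variable {A : Matrix (Fin d) (Fin d) ℝ} {p h K : ℝ} {ν : Matrix (Fin d) (Fin d) ℝ → ℝ}

/-- Unique solvability of the Lyapunov equation `A S + S Aᵀ + c S = Y`. -/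
theorem IsAdaptedNorm.existsUnique_lyapunov (hν : IsAdaptedNorm A Aᵀ p h K ν) (hh : 0 < h)
    {c : ℝ} (hc : c < 2 * p) (Y : Matrix (Fin d) (Fin d) ℝ) :
    ∃! S, A * S + S * Aᵀ + c • S = Y := by
  let T : Matrix (Fin d) (Fin d) ℝ →ₗ[ℝ] Matrix (Fin d) (Fin d) ℝ :=
    LinearMap.mulLeft ℝ A + LinearMap.mulRight ℝ Aᵀ + c • LinearMap.id
  have hT : ∀ S, T S = A * S + S * Aᵀ + c • S := fun S => by simp [T]
  have hinj : Function.Injective T := by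
    rw [← LinearMap.ker_eq_bot, LinearMap.ker_eq_bot']
    intro S hS
    rw [hT] at hS
    exact hν.eq_zero_of_mul_add_mul hh hc (eq_neg_of_add_eq_zero_left hS)
  obtain ⟨S, hS⟩ := LinearMap.injective_iff_surjective.1 hinj Y
  exact ⟨S, (hT S).symm.trans hS, fun S' hS' => hinj (((hT S').trans hS').trans hS.symm)⟩

theorem isLyapunov_iff {Q S : Matrix (Fin d) (Fin d) ℝ} :
    IsLyapunov A Q S ↔ A * S + S * Aᵀ + (1 : ℝ) • S = -Q := by
  rw [IsLyapunov, add_eq_zero_iff_eq_neg]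
  simp only [transpose_add, transpose_smul, transpose_one, add_mul, mul_add, smul_mul_assoc,
    mul_smul_comm, one_mul, mul_one]
  rw [show (1 / 2 : ℝ) • S + A * S + ((1 / 2 : ℝ) • S + S * Aᵀ) = A * S + S * Aᵀ + (1 : ℝ) • S
    by module]

/-- The shift is now c = 2, and c < 2p says p > 1: solvability here uses the eigenvalue gap beyond
-1. -/
theorem isLyapunovTwo_iff {Q Sθ C D S : Matrix (Fin d) (Fin d) ℝ} :
    IsLyapunovTwo A Q Sθ C D S ↔ A * S + S * Aᵀ + (2 : ℝ) • S =
      (1 + A) * C + D * (1 + A)ᵀ - A * Sθ * Aᵀ + Q := by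
  rw [IsLyapunovTwo, ← sub_eq_zero (a := A * S + S * Aᵀ + (2 : ℝ) • S)]
  simp only [transpose_add, transpose_one, add_mul, mul_add, sub_mul, mul_sub, one_mul, mul_one]
  refine Eq.congr ?_ rfl
  module

theorem norm_le_of_forall_smul {B : ℝ} {X : Matrix (Fin d) (Fin d) ℝ} {x : ℝ} (hx : 0 ≤ x)
    (hX : ‖X‖ ≤ B) : ‖x • X‖ ≤ B * x := by
  rw [norm_smul, Real.norm_eq_abs, abs_of_nonneg hx, mul_comm]
  exact mul_le_mul_of_nonneg_right hX hx

/-- The solution of the Lyapunov equation with a positive semidefinite right-hand side is positive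
semidefinite. -/
theorem IsAdaptedNorm.posSemidef_of_isLyapunov (hν : IsAdaptedNorm A Aᵀ p h K ν) (hK : 0 ≤ K)
    (hh : 0 < h) (hp : 1 ≤ p) {Q S : Matrix (Fin d) (Fin d) ℝ} (hQ : Q.PosSemidef)
    (hS : IsLyapunov A Q S) : S.PosSemidef := by
  rw [isLyapunov_iff, one_smul] at hS
  -- D n is the covariance of the recursion started at 0 and driven by white noise of covariance Q.
  -- It is visibly positive semidefinite, and n D n → S, so S inherits the property.
  let D : ℕ → Matrix (Fin d) (Fin d) ℝ := fun n => Nat.rec 0 (fun n X =>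
    (1 + (1 / ((n : ℝ) + 1)) • A) * X * (1 + (1 / ((n : ℝ) + 1)) • Aᵀ)
      + (1 / ((n : ℝ) + 1)) ^ 2 • Q) n
  have hD : ∀ n : ℕ, D (n + 1) = (1 + (1 / ((n : ℝ) + 1)) • A) * D n *
      (1 + (1 / ((n : ℝ) + 1)) • Aᵀ) + (1 / ((n : ℝ) + 1)) ^ 2 • Q := fun n => rfl
  have hpsd : ∀ n, (D n).PosSemidef := by
    intro n
    induction n with
    | zero => exact Matrix.PosSemidef.zero
    | succ n ih =>
      rw [hD]
      refine Matrix.PosSemidef.add ?_ (hQ.smul (by positivity))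
      have := ih.mul_mul_conjTranspose_same (1 + (1 / ((n : ℝ) + 1)) • A)
      simpa [Matrix.conjTranspose_eq_transpose_of_trivial] using this
  -- The remainder is of order n⁻³ = n^(-(2·(3/4) + 3/2)), hence the exponent 3/4. The error of D n
  -- is then O(n^(-3/2)), and after multiplication by n still O(n^(-1/2)).
  obtain ⟨L, hL⟩ := hν.bound_of_recursion hK hh hp (p' := 3 / 4) (by linarith)
    (E := fun n => D n - (1 / (n : ℝ)) • S)
    (Rm := fun n => (1 / ((n : ℝ) + 1)) ^ 3 • (S + A * S + S * Aᵀ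
      + (((n : ℝ) + 1) / n) • (S + A * S + S * Aᵀ + A * S * Aᵀ) - (S + A * S + S * Aᵀ)))
    (c := ‖S + A * S + S * Aᵀ‖ + 2 * ‖S + A * S + S * Aᵀ + A * S * Aᵀ‖ + ‖S + A * S + S * Aᵀ‖)
    (fun n hn => by
      have hn0 : (n : ℝ) ≠ 0 := by
        have : n ≠ 0 := by omega
        exact_mod_cast this
      have hn1 : (n : ℝ) + 1 ≠ 0 := by positivity
      have hQS : Q = -(S + A * S + S * Aᵀ) := by
        rw [show S + A * S + S * Aᵀ = A * S + S * Aᵀ + S by abel, hS, neg_neg]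
      simp only [hD]
      rw [hQS]
      simp only [mul_sub, sub_mul, add_mul, mul_add, one_mul, mul_one, smul_mul_assoc,
        mul_smul_comm]
      push_cast
      match_scalars <;> field_simp <;> ring)
    (fun n hn => by
      have hn0 : (1 : ℝ) ≤ n := by exact_mod_cast hn
      have e : ((n : ℝ) + 1) ^ (-(2 * (3 / 4) + 3 / 2 : ℝ)) = (1 / ((n : ℝ) + 1)) ^ 3 := by
        rw [Real.rpow_neg (by positivity), one_div, inv_pow]
        norm_num
      rw [e]
      refine norm_le_of_forall_smul (by positivity) ?_
      refine (norm_sub_le _ _).trans (add_le_add ((norm_add_le _ _).trans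
        (add_le_add le_rfl ?_)) le_rfl)
      rw [norm_smul, Real.norm_eq_abs, abs_of_nonneg (by positivity)]
      refine mul_le_mul_of_nonneg_right ?_ (norm_nonneg _)
      rw [div_le_iff₀ (by positivity)]; linarith)
  have hlim : Tendsto (fun n : ℕ => ‖(n : ℝ) • D n - S‖) atTop (𝓝 0) := by
    have h0 : Tendsto (fun n : ℕ => L * (n : ℝ) ^ (-(1 / 2 : ℝ))) atTop (𝓝 0) := by
      have := ((tendsto_rpow_neg_atTop (by norm_num : (0 : ℝ) < 1 / 2)).comp
        tendsto_natCast_atTop_atTop).const_mul L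
      simpa using this
    refine squeeze_zero' (Eventually.of_forall fun n => norm_nonneg _) ?_ h0
    filter_upwards [eventually_ge_atTop 1] with n hn
    have hn0 : (0 : ℝ) < n := by exact_mod_cast hn
    have e : (n : ℝ) • D n - S = (n : ℝ) • (D n - (1 / (n : ℝ)) • S) := by
      rw [smul_sub, smul_smul, mul_one_div_cancel hn0.ne', one_smul]
    rw [e, norm_smul, Real.norm_eq_abs, abs_of_pos hn0]
    refine (mul_le_mul_of_nonneg_left (hL n hn) hn0.le).trans (le_of_eq ?_)
    rw [mul_left_comm, show (-(1 / 2) : ℝ) = 1 + -(2 * (3 / 4)) by norm_num,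
      Real.rpow_add hn0, Real.rpow_one]
  have hpsd' : ∀ n : ℕ, ((n : ℝ) • D n).PosSemidef := fun n => (hpsd n).smul (by positivity)
  have hent : ∀ i j, Tendsto (fun n : ℕ => ((n : ℝ) • D n) i j) atTop (𝓝 (S i j)) := fun i j => by
    have := (squeeze_zero_norm (fun n : ℕ => abs_apply_le_norm ((n : ℝ) • D n - S) i j)
      hlim).add_const (S i j)
    simpa using this
  refine Matrix.PosSemidef.of_dotProduct_mulVec_nonneg ?_ fun x => ?_
  · ext i j
    refine tendsto_nhds_unique (f := fun n : ℕ => ((n : ℝ) • D n) j i) (by simpa using hent j i)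
      ((hent i j).congr fun n => ?_)
    simpa using ((hpsd' n).1.apply i j).symm
  · refine ge_of_tendsto' (f := fun n : ℕ => star x ⬝ᵥ ((n : ℝ) • D n) *ᵥ x) (x := atTop) ?_
      fun n => (hpsd' n).dotProduct_mulVec_nonneg x
    simp only [dotProduct, mulVec]
    exact tendsto_finsetSum _ fun i _ => (tendsto_finsetSum _ fun j _ =>
      (hent i j).mul_const _).const_mul _

end LyapunovTheory

/-! ### Second-order expansions of the abstract moment recursions. -/

section Expansion

variable {R : Type*} [NormedRing R] [NormedAlgebra ℝ R]

/-- A sequence that is bounded from index one on. -/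
def IsBddSeq {E : Type*} [Norm E] (F : ℕ → E) : Prop := ∃ c : ℝ, ∀ n : ℕ, 1 ≤ n → ‖F n‖ ≤ c

theorem IsBddSeq.const {E : Type*} [Norm E] (X : E) : IsBddSeq fun _ => X :=
  ⟨‖X‖, fun _ _ => le_rfl⟩

theorem IsBddSeq.add {E : Type*} [SeminormedAddCommGroup E] {F G : ℕ → E} (hF : IsBddSeq F)
    (hG : IsBddSeq G) : IsBddSeq fun n => F n + G n := by
  obtain ⟨c, hc⟩ := hF
  obtain ⟨c', hc'⟩ := hG
  exact ⟨c + c', fun n hn => (norm_add_le _ _).trans (add_le_add (hc n hn) (hc' n hn))⟩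

theorem IsBddSeq.mul {R : Type*} [NormedRing R] {F G : ℕ → R} (hF : IsBddSeq F)
    (hG : IsBddSeq G) : IsBddSeq fun n => F n * G n := by
  obtain ⟨c, hc⟩ := hF
  obtain ⟨c', hc'⟩ := hG
  exact ⟨c * c', fun n hn => (norm_mul_le _ _).trans (mul_le_mul (hc n hn) (hc' n hn)
    (norm_nonneg _) ((norm_nonneg _).trans (hc n hn)))⟩

theorem IsBddSeq.smul {E : Type*} [SeminormedAddCommGroup E] [NormedSpace ℝ E] {t : ℕ → ℝ}
    {F : ℕ → E} (ht : IsBddSeq t) (hF : IsBddSeq F) : IsBddSeq fun n => t n • F n := by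
  obtain ⟨c, hc⟩ := ht
  obtain ⟨c', hc'⟩ := hF
  exact ⟨c * c', fun n hn => (norm_smul_le _ _).trans (mul_le_mul (hc n hn) (hc' n hn)
    (norm_nonneg _) ((norm_nonneg _).trans (hc n hn)))⟩

theorem isBddSeq_ratio : IsBddSeq fun n : ℕ => ((n : ℝ) + 1) / n := ⟨2, fun n hn => by
  have hn0 : (1 : ℝ) ≤ n := by exact_mod_cast hn
  rw [Real.norm_eq_abs, abs_of_nonneg (by positivity), div_le_iff₀ (by positivity)]; linarith⟩

theorem isBddSeq_inv : IsBddSeq fun n : ℕ => 1 / ((n : ℝ) + 1) := ⟨1, fun n hn => by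
  have hn0 : (0 : ℝ) ≤ n := by positivity
  rw [Real.norm_eq_abs, abs_of_nonneg (by positivity), div_le_one (by positivity)]; linarith⟩

theorem exists_pow_le_sq {r : ℝ} (hr0 : 0 ≤ r) (hr1 : r < 1) :
    ∃ c : ℝ, 0 ≤ c ∧ ∀ n : ℕ, r ^ n ≤ c * (1 / ((n : ℝ) + 1)) ^ 2 := by
  have h := tendsto_pow_const_mul_const_pow_of_abs_lt_one 2 (abs_lt.2 ⟨by linarith, hr1⟩)
  obtain ⟨b, hb⟩ := h.bddAbove_range
  have hb0 : 0 ≤ b := by simpa using hb ⟨0, rfl⟩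
  refine ⟨1 + 4 * b, by positivity, fun n => ?_⟩
  have hbn : (n : ℝ) ^ 2 * r ^ n ≤ b := hb ⟨n, rfl⟩
  rw [one_div, inv_pow, ← div_eq_mul_inv, le_div_iff₀ (by positivity)]
  rcases Nat.eq_zero_or_pos n with rfl | hn
  · simp; linarith
  · have hn1 : (1 : ℝ) ≤ n := by exact_mod_cast hn
    have : r ^ n * ((n : ℝ) + 1) ^ 2 ≤ r ^ n * (4 * (n : ℝ) ^ 2) :=
      mul_le_mul_of_nonneg_left (by nlinarith) (by positivity)
    linarith

/-- Second-order expansion for a recursion that shifts a geometrically decaying lag index: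
`m_{n+1}(k) = (1 + A/(n+1)) m_n(k+1) + (S_k + e_{n,k})/(n+1)`. -/
theorem lag_expansion {A : R} {m e : ℕ → ℕ → R} {S μ₁ μ₂ : ℕ → R} {r c : ℝ} (hr0 : 0 < r)
    (hr1 : r < 1)
    (hm : ∀ n k : ℕ, m (n + 1) k = (1 + (1 / ((n : ℝ) + 1)) • A) * m n (k + 1)
      + (1 / ((n : ℝ) + 1)) • (S k + e n k))
    (hμ₁ : ∀ k, μ₁ k = μ₁ (k + 1) + S k)
    (hμ₂ : ∀ k, μ₂ k = μ₂ (k + 1) + (1 + A) * μ₁ (k + 1))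
    (hm0 : ∀ k, ‖m 0 k‖ ≤ c * r ^ k)
    (hb₁ : ∀ k, ‖μ₁ k‖ ≤ c * r ^ k) (hb₂ : ∀ k, ‖μ₂ k‖ ≤ c * r ^ k)
    (he : ∀ n k, ‖e n k‖ ≤ c * r ^ k * r ^ n) :
    ∃ L : ℝ, ∀ n : ℕ, 1 ≤ n → ∀ k,
      ‖m n k - (1 / (n : ℝ)) • μ₁ k - (1 / (n : ℝ)) ^ 2 • μ₂ k‖
        ≤ L * (1 / (n : ℝ)) ^ 3 * r ^ k := by
  set a := ‖A‖ with ha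
  have ha0 : 0 ≤ a := norm_nonneg _
  have hc : 0 ≤ c := by simpa using (norm_nonneg _).trans (hm0 0)
  have hrk : ∀ k, r ^ (k + 1) ≤ r ^ k := fun k => pow_le_pow_of_le_one hr0.le hr1.le (by simp)
  have hAmul : ∀ X : R, ‖A * X‖ ≤ a * ‖X‖ := norm_mul_le A
  have hstepmul : ∀ (x : ℝ) (X : R), 0 ≤ x → ‖(1 + x • A) * X‖ ≤ (1 + x * a) * ‖X‖ := by
    intro x X hx
    rw [add_mul, one_mul, smul_mul_assoc]
    refine (norm_add_le _ _).trans ?_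
    rw [norm_smul, Real.norm_eq_abs, abs_of_nonneg hx]
    nlinarith [mul_le_mul_of_nonneg_left (hAmul X) hx]
  -- No uniformity in n: this only ensures that each row is finite in the norm weighted by r⁻ᵏ,
  -- which handles the finitely many initial n.
  have hcrude : ∀ n, ∃ G : ℝ, 0 ≤ G ∧ ∀ k, ‖m n k‖ ≤ G * r ^ k := by
    intro n
    induction n with
    | zero => exact ⟨c, hc, hm0⟩
    | succ n ih =>
      obtain ⟨G, hG0, hG⟩ := ih
      set x : ℝ := 1 / ((n : ℝ) + 1) with hx
      have hx0 : 0 ≤ x := by positivity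
      refine ⟨(1 + x * a) * G + x * ((c + c) + c), by positivity, fun k => ?_⟩
      have hSk : ‖S k‖ ≤ (c + c) * r ^ k := by
        rw [show S k = μ₁ k - μ₁ (k + 1) by rw [hμ₁ k]; abel, add_mul]
        exact (norm_sub_le _ _).trans (add_le_add (hb₁ k) ((hb₁ _).trans
          (mul_le_mul_of_nonneg_left (hrk k) hc)))
      have hek : ‖e n k‖ ≤ c * r ^ k := (he n k).trans
        (mul_le_of_le_one_right (by positivity) (pow_le_one₀ hr0.le hr1.le))
      rw [hm, add_mul _ _ (r ^ k)]
      refine (norm_add_le _ _).trans (add_le_add ?_ ?_)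
      · refine (hstepmul _ _ hx0).trans ?_
        rw [mul_assoc]
        exact mul_le_mul_of_nonneg_left ((hG _).trans
          (mul_le_mul_of_nonneg_left (hrk k) hG0)) (by positivity)
      · rw [norm_smul, Real.norm_eq_abs, abs_of_nonneg hx0, mul_assoc, add_mul _ _ (r ^ k)]
        exact mul_le_mul_of_nonneg_left ((norm_add_le _ _).trans (add_le_add hSk hek)) hx0
  obtain ⟨c₂, hc₂0, hc₂⟩ := exists_pow_le_sq hr0.le hr1
  set b : ℕ → ℕ → R := fun n k =>
    m n k - (1 / (n : ℝ)) • μ₁ k - (1 / (n : ℝ)) ^ 2 • μ₂ k with hbdef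
  -- The five remainder terms below contribute 2c + 6c (from μ₁, μ₂), 2ac + 4ac (from Aμ₁, Aμ₂) and
  -- c c₂ (from e, whose decay rⁿ is at most c₂ x²).
  set H : ℝ := 8 * c + 6 * (a * c) + c * c₂ with hH
  have hH0 : 0 ≤ H := by positivity
  have hstep : ∀ n : ℕ, 1 ≤ n → ∀ k, ‖b (n + 1) k‖ ≤
      (1 + 1 / ((n : ℝ) + 1) * a) * ‖b n (k + 1)‖ + H * (1 / ((n : ℝ) + 1)) ^ 3 * r ^ k := by
    intro n hn k
    have hn1 : (1 : ℝ) ≤ n := by exact_mod_cast hn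
    set x : ℝ := 1 / ((n : ℝ) + 1) with hx
    set y : ℝ := 1 / (n : ℝ) with hy
    have hx0 : 0 ≤ x := by positivity
    have hy0 : 0 ≤ y := by positivity
    -- All cancellations rest on this identity; the equations for μ₁ and μ₂ remove the terms of
    -- orders 1/n and 1/n².
    have hxy : y - x = x * y := by rw [hx, hy]; field_simp; ring
    have hx1 : x ≤ 1 := by rw [hx, div_le_one (by positivity)]; linarith
    have hy1 : y ≤ 1 := by rw [hy, div_le_one (by positivity)]; exact hn1
    have hy2x : y ≤ 2 * x := by nlinarith
    have e1 : b (n + 1) k = (1 + x • A) * b n (k + 1) + ((x ^ 2 * y) • μ₁ (k + 1)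
        + (x * y * (x + y)) • μ₂ (k + 1) + (x ^ 2 * y) • (A * μ₁ (k + 1))
        + (x * y ^ 2) • (A * μ₂ (k + 1)) + x • e n k) := by
      simp only [hbdef]
      push_cast
      rw [← hx, ← hy, hm, ← hx, hμ₁ k, hμ₂ k]
      simp only [add_mul, mul_add, mul_sub, one_mul, smul_mul_assoc, mul_smul_comm]
      match_scalars <;> try ring1
      · linear_combination (1 + x) * hxy
      · linear_combination (x + y) * hxy
      · linear_combination x * hxy
    have hμ1' : ‖μ₁ (k + 1)‖ ≤ c * r ^ k := (hb₁ _).trans (mul_le_mul_of_nonneg_left (hrk k) hc)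
    have hμ2' : ‖μ₂ (k + 1)‖ ≤ c * r ^ k := (hb₂ _).trans (mul_le_mul_of_nonneg_left (hrk k) hc)
    have hAμ1 : ‖A * μ₁ (k + 1)‖ ≤ a * (c * r ^ k) :=
      (hAmul _).trans (mul_le_mul_of_nonneg_left hμ1' ha0)
    have hAμ2 : ‖A * μ₂ (k + 1)‖ ≤ a * (c * r ^ k) :=
      (hAmul _).trans (mul_le_mul_of_nonneg_left hμ2' ha0)
    have hxe : ‖e n k‖ ≤ c * r ^ k * (c₂ * x ^ 2) :=
      (he n k).trans (mul_le_mul_of_nonneg_left (hc₂ n) (by positivity))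
    have hsm : ∀ (t s : ℝ) (X : R) (B : ℝ), 0 ≤ t → t ≤ s → ‖X‖ ≤ B → ‖t • X‖ ≤ s * B := by
      intro t s X B ht hts hX
      rw [norm_smul, Real.norm_eq_abs, abs_of_nonneg ht]
      exact mul_le_mul hts hX (norm_nonneg _) (ht.trans hts)
    have hx2 : 0 ≤ x ^ 2 := by positivity
    have q1 : x ^ 2 * y ≤ 2 * x ^ 3 := by nlinarith
    have q3 : x * y ^ 2 ≤ 4 * x ^ 3 := by
      have : y ^ 2 ≤ (2 * x) ^ 2 := pow_le_pow_left₀ hy0 hy2x 2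
      nlinarith
    have q2 : x * y * (x + y) ≤ 6 * x ^ 3 := by nlinarith
    rw [e1]
    refine (norm_add_le _ _).trans (add_le_add (hstepmul _ _ hx0) ?_)
    have hck : 0 ≤ c * r ^ k := by positivity
    refine (norm_add_le _ _).trans ((add_le_add ((norm_add_le _ _).trans (add_le_add
      ((norm_add_le _ _).trans (add_le_add ((norm_add_le _ _).trans (add_le_add
      (hsm _ _ _ _ (by positivity) q1 hμ1') (hsm _ _ _ _ (by positivity) q2 hμ2')))
      (hsm _ _ _ _ (by positivity) q1 hAμ1))) (hsm _ _ _ _ (by positivity) q3 hAμ2)))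
      (hsm _ _ _ _ hx0 le_rfl hxe)).trans (le_of_eq ?_))
    rw [hH]; ring
  -- The factor by which the target bound n⁻³ rᵏ is reproduced in one step: the gain r from the lag
  -- shift beats the growth of 1 + xA and the change of n⁻³.
  have hratio : Tendsto (fun n : ℕ => (1 + 1 / ((n : ℝ) + 1) * a) * (((n : ℝ) + 1) / n) ^ 3 * r)
      atTop (𝓝 r) := by
    have h1 : Tendsto (fun n : ℕ => 1 / ((n : ℝ) + 1)) atTop (𝓝 0) :=
      tendsto_one_div_add_atTop_nhds_zero_nat
    have h2 : Tendsto (fun n : ℕ => ((n : ℝ) + 1) / n) atTop (𝓝 1) := by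
      have h3 : Tendsto (fun n : ℕ => 1 + 1 / (n : ℝ)) atTop (𝓝 (1 + 0)) :=
        tendsto_const_nhds.add tendsto_one_div_atTop_nhds_zero_nat
      rw [add_zero] at h3
      refine h3.congr' ?_
      filter_upwards [eventually_ge_atTop 1] with n hn
      have : (n : ℝ) ≠ 0 := by
        have : n ≠ 0 := by omega
        exact_mod_cast this
      field_simp
    have := (((h1.mul_const a).const_add 1).mul (h2.pow 3)).mul_const r
    simpa using this
  obtain ⟨n₀, hn₀⟩ := eventually_atTop.1
    (hratio.eventually_lt_const (by linarith : r < (1 + r) / 2))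
  have hbcrude : ∀ n, ∃ G : ℝ, 0 ≤ G ∧ ∀ k, ‖b n k‖ ≤ G * r ^ k := by
    intro n
    obtain ⟨G, hG0, hG⟩ := hcrude n
    refine ⟨G + 1 / (n : ℝ) * c + (1 / (n : ℝ)) ^ 2 * c, by positivity, fun k => ?_⟩
    simp only [hbdef]
    refine (norm_sub_le _ _).trans ?_
    rw [add_mul]
    refine add_le_add ((norm_sub_le _ _).trans ?_) ?_
    · rw [add_mul]
      refine add_le_add (hG k) ?_
      rw [norm_smul, Real.norm_eq_abs, abs_of_nonneg (by positivity), mul_assoc]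
      exact mul_le_mul_of_nonneg_left (hb₁ k) (by positivity)
    · rw [norm_smul, Real.norm_eq_abs, abs_of_nonneg (by positivity), mul_assoc]
      exact mul_le_mul_of_nonneg_left (hb₂ k) (by positivity)
  choose G hG0 hG using hbcrude
  set n₁ := max n₀ 1
  -- The sum serves n ≤ n₁; the other summand makes H at most (1 - r)/2 · L, which closes the
  -- induction with factor (1 + r)/2.
  set L : ℝ := (∑ n ∈ Finset.range (n₁ + 1), G n * (n : ℝ) ^ 3) + 2 * H / (1 - r) with hL
  have hsum0 : 0 ≤ ∑ n ∈ Finset.range (n₁ + 1), G n * (n : ℝ) ^ 3 :=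
    Finset.sum_nonneg fun n _ => mul_nonneg (hG0 n) (by positivity)
  have h1r : 0 < 1 - r := by linarith
  have hLH : H ≤ (1 - r) / 2 * L := by
    have : (1 - r) / 2 * (2 * H / (1 - r)) = H := by field_simp
    rw [hL, mul_add, this]
    have : 0 ≤ (1 - r) / 2 * ∑ n ∈ Finset.range (n₁ + 1), G n * (n : ℝ) ^ 3 := by positivity
    linarith
  have hL0 : 0 ≤ L := by rw [hL]; positivity
  have hsmall : ∀ n : ℕ, 1 ≤ n → n ≤ n₁ → ∀ k, ‖b n k‖ ≤ L * (1 / (n : ℝ)) ^ 3 * r ^ k := by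
    intro n hn hnn k
    have hn1 : (0 : ℝ) < n := by exact_mod_cast hn
    have h1 : G n * (n : ℝ) ^ 3 ≤ L := by
      have := Finset.single_le_sum (f := fun n : ℕ => G n * (n : ℝ) ^ 3)
        (fun n _ => mul_nonneg (hG0 n) (by positivity)) (Finset.mem_range.2 (Nat.lt_succ_of_le hnn))
      have h2 : 0 ≤ 2 * H / (1 - r) := by positivity
      linarith
    refine (hG n k).trans (mul_le_mul_of_nonneg_right ?_ (by positivity))
    rw [one_div, inv_pow, ← div_eq_mul_inv, le_div_iff₀ (by positivity)]
    exact h1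
  refine ⟨L, fun n hn => ?_⟩
  rcases le_or_gt n n₁ with h | h
  · exact hsmall n hn h
  · induction n, h.le using Nat.le_induction with
    | base => exact hsmall n₁ (le_max_right _ _) le_rfl
    | succ n hnn ih =>
      intro k
      have hn1 : 1 ≤ n := (le_max_right _ _).trans hnn
      have hn' : (0 : ℝ) < n := by exact_mod_cast hn1
      have ihn : ∀ k, ‖b n k‖ ≤ L * (1 / (n : ℝ)) ^ 3 * r ^ k := by
        rcases eq_or_lt_of_le hnn with h' | h'
        · exact hsmall n hn1 h'.ge
        · exact ih hn1 h'
      refine (hstep n hn1 k).trans ?_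
      have hq := (hn₀ n ((le_max_left _ _).trans hnn)).le
      set x : ℝ := 1 / ((n : ℝ) + 1) with hx
      have hx0 : 0 < x := by positivity
      have e2 : (1 / (n : ℝ)) ^ 3 = (((n : ℝ) + 1) / n) ^ 3 * x ^ 3 := by
        rw [hx]; field_simp
      calc (1 + x * a) * ‖b n (k + 1)‖ + H * x ^ 3 * r ^ k
          ≤ (1 + x * a) * (L * (1 / (n : ℝ)) ^ 3 * r ^ (k + 1)) + H * x ^ 3 * r ^ k :=
            add_le_add (mul_le_mul_of_nonneg_left (ihn (k + 1)) (by positivity)) le_rfl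
        _ = (((1 + x * a) * (((n : ℝ) + 1) / n) ^ 3 * r) * L + H) * (x ^ 3 * r ^ k) := by
            rw [e2]; ring
        _ ≤ ((1 + r) / 2 * L + (1 - r) / 2 * L) * (x ^ 3 * r ^ k) := by
            refine mul_le_mul_of_nonneg_right (add_le_add ?_ hLH) (by positivity)
            exact mul_le_mul_of_nonneg_right hq hL0
        _ = _ := by push_cast; rw [← hx]; ring

/-- Second-order expansion of the solution of
`C_{n+1} = (1 + A/(n+1)) C_n (1 + A'/(n+1)) + (cross terms) + (S₀ + e_n)/(n+1)²`. -/
theorem IsAdaptedNorm.covariance_expansion {A A' : R} {p h K : ℝ} {ν : R → ℝ}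
    (hν : IsAdaptedNorm A A' p h K ν) (hK : 0 ≤ K) (hh : 0 < h) (hp1 : 1 ≤ p) (hp2 : p ≤ 5 / 4)
    {C m m' e : ℕ → R} {S₀ Sθ S₂ μ₁ μ₂ μ₁' μ₂' : R}
    (hC : ∀ n : ℕ, C (n + 1) = (1 + (1 / ((n : ℝ) + 1)) • A) * C n * (1 + (1 / ((n : ℝ) + 1)) • A')
      + (1 / ((n : ℝ) + 1)) • ((1 + (1 / ((n : ℝ) + 1)) • A) * m n)
      + (1 / ((n : ℝ) + 1)) • (m' n * (1 + (1 / ((n : ℝ) + 1)) • A'))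
      + (1 / ((n : ℝ) + 1)) ^ 2 • (S₀ + e n))
    {L : ℝ}
    (hm : ∀ n : ℕ, 1 ≤ n → ‖m n - (1 / (n : ℝ)) • μ₁ - (1 / (n : ℝ)) ^ 2 • μ₂‖
      ≤ L * (1 / (n : ℝ)) ^ 3)
    (hm' : ∀ n : ℕ, 1 ≤ n → ‖m' n - (1 / (n : ℝ)) • μ₁' - (1 / (n : ℝ)) ^ 2 • μ₂'‖
      ≤ L * (1 / (n : ℝ)) ^ 3)
    (he : ∀ n : ℕ, 1 ≤ n → ‖e n‖ ≤ L * (1 / ((n : ℝ) + 1)) ^ 2)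
    (h1 : A * Sθ + Sθ * A' + Sθ + (μ₁ + μ₁' + S₀) = 0)
    (h2 : Sθ + A * Sθ + Sθ * A' + A * Sθ * A' + (2 : ℝ) • S₂ + A * S₂ + S₂ * A'
      + (μ₁ + A * μ₁ + μ₂) + (μ₁' + μ₁' * A' + μ₂') = 0) :
    ∃ M : ℝ, ∀ n : ℕ, 1 ≤ n →
      ‖C n - (1 / (n : ℝ)) • Sθ - (1 / (n : ℝ)) ^ 2 • S₂‖ ≤ M * (n : ℝ) ^ (-(2 * p)) := by
  -- w, w' and v are the rescaled remainders, bounded by hypothesis; they turn the expansions into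
  -- exact identities.
  let w : ℕ → R := fun n => (n : ℝ) ^ 3 • (m n - (1 / (n : ℝ)) • μ₁ - (1 / (n : ℝ)) ^ 2 • μ₂)
  let w' : ℕ → R := fun n => (n : ℝ) ^ 3 • (m' n - (1 / (n : ℝ)) • μ₁' - (1 / (n : ℝ)) ^ 2 • μ₂')
  let v : ℕ → R := fun n => ((n : ℝ) + 1) ^ 2 • e n
  have hw : ∀ n : ℕ, 1 ≤ n →
      m n = (1 / (n : ℝ)) • μ₁ + (1 / (n : ℝ)) ^ 2 • μ₂ + (1 / (n : ℝ)) ^ 3 • w n := by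
    intro n hn
    have hn0 : (n : ℝ) ≠ 0 := by positivity
    simp only [w]
    rw [smul_smul, ← mul_pow, one_div_mul_cancel hn0, one_pow, one_smul]; abel
  have hw' : ∀ n : ℕ, 1 ≤ n →
      m' n = (1 / (n : ℝ)) • μ₁' + (1 / (n : ℝ)) ^ 2 • μ₂' + (1 / (n : ℝ)) ^ 3 • w' n := by
    intro n hn
    have hn0 : (n : ℝ) ≠ 0 := by positivity
    simp only [w']
    rw [smul_smul, ← mul_pow, one_div_mul_cancel hn0, one_pow, one_smul]; abel
  have hv : ∀ n : ℕ, e n = (1 / ((n : ℝ) + 1)) ^ 2 • v n := by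
    intro n
    have hn0 : (n : ℝ) + 1 ≠ 0 := by positivity
    simp only [v]
    rw [smul_smul, ← mul_pow, one_div_mul_cancel hn0, one_pow, one_smul]
  have hwb : ∀ (F : ℕ → R), (∀ n : ℕ, 1 ≤ n → ‖F n‖ ≤ L * (1 / (n : ℝ)) ^ 3) →
      IsBddSeq fun n => (n : ℝ) ^ 3 • F n := by
    refine fun F hF => ⟨L, fun n hn => ?_⟩
    have hn0 : (0 : ℝ) < n := by exact_mod_cast hn
    rw [norm_smul, Real.norm_eq_abs, abs_of_nonneg (by positivity)]
    refine (mul_le_mul_of_nonneg_left (hF n hn) (by positivity)).trans (le_of_eq ?_)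
    field_simp
  have hbw : IsBddSeq w := hwb _ hm
  have hbw' : IsBddSeq w' := hwb _ hm'
  have hbv : IsBddSeq v := by
    refine ⟨L, fun n hn => ?_⟩
    simp only [v]
    rw [norm_smul, Real.norm_eq_abs, abs_of_nonneg (by positivity)]
    refine (mul_le_mul_of_nonneg_left (he n hn) (by positivity)).trans (le_of_eq ?_)
    field_simp
  have ht := isBddSeq_ratio
  have hx := isBddSeq_inv
  have hc := fun X : R => IsBddSeq.const X
  -- With t = (n+1)/n, one has 1/n = xt and t = 1 + xt. Expanding repeatedly in x leaves the `h1`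
  -- expression at x², the `h2` expression at x³, and this bounded coefficient at x⁴.
  let rest : ℕ → R := fun n =>
    let t : ℝ := ((n : ℝ) + 1) / n
    let x : ℝ := 1 / ((n : ℝ) + 1)
    t • (Sθ + A * Sθ + Sθ * A' + A * Sθ * A' + μ₁ + A * μ₁ + μ₁' + μ₁' * A'
      + (3 : ℝ) • S₂ + A * S₂ + S₂ * A' + μ₂ + μ₂')
    + x • t • t • S₂ + t • t • (A * S₂ + S₂ * A' + A * S₂ * A' + μ₂ + μ₂' + A * μ₂ + μ₂' * A')
    + t • t • t • (w n + w' n) + x • t • t • t • (A * w n + w' n * A') + v n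
  have hrest : IsBddSeq rest :=
    (((((ht.smul (hc _)).add (hx.smul (ht.smul (ht.smul (hc _))))).add
      (ht.smul (ht.smul (hc _)))).add (ht.smul (ht.smul (ht.smul (hbw.add hbw'))))).add
      (hx.smul (ht.smul (ht.smul (ht.smul (((hc _).mul hbw).add (hbw'.mul (hc _)))))))).add hbv
  obtain ⟨c, hcb⟩ := hrest
  have hc0 : 0 ≤ c := (norm_nonneg _).trans (hcb 1 le_rfl)
  refine hν.bound_of_recursion hK hh hp1 le_rfl
    (E := fun n : ℕ => C n - (1 / (n : ℝ)) • Sθ - (1 / (n : ℝ)) ^ 2 • S₂)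
    (Rm := fun n => (1 / ((n : ℝ) + 1)) ^ 4 • rest n) (c := c) ?_ ?_
  · intro n hn
    have hn0 : (n : ℝ) ≠ 0 := by positivity
    have hn1 : (n : ℝ) + 1 ≠ 0 := by positivity
    have key : C (n + 1) - (1 / ((n + 1 : ℕ) : ℝ)) • Sθ - (1 / ((n + 1 : ℕ) : ℝ)) ^ 2 • S₂ =
        (1 + (1 / ((n : ℝ) + 1)) • A) * (C n - (1 / (n : ℝ)) • Sθ - (1 / (n : ℝ)) ^ 2 • S₂)
          * (1 + (1 / ((n : ℝ) + 1)) • A') + (1 / ((n : ℝ) + 1)) ^ 4 • rest n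
        + (1 / ((n : ℝ) + 1)) ^ 2 • (A * Sθ + Sθ * A' + Sθ + (μ₁ + μ₁' + S₀))
        + (1 / ((n : ℝ) + 1)) ^ 3 • (Sθ + A * Sθ + Sθ * A' + A * Sθ * A' + (2 : ℝ) • S₂ + A * S₂
          + S₂ * A' + (μ₁ + A * μ₁ + μ₂) + (μ₁' + μ₁' * A' + μ₂')) := by
      rw [hC, hw n hn, hw' n hn, hv]
      simp only [rest, mul_sub, sub_mul, add_mul, mul_add, one_mul, mul_one, smul_mul_assoc,
        mul_smul_comm]
      push_cast
      match_scalars <;> field_simp <;> ring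
    rw [key, h1, h2, smul_zero, smul_zero, add_zero, add_zero]
  · intro n hn
    have hN : (0 : ℝ) < (n : ℝ) + 1 := by positivity
    rw [norm_smul, Real.norm_eq_abs, abs_of_nonneg (by positivity), mul_comm]
    refine mul_le_mul (hcb n hn) ?_ (by positivity) hc0
    rw [one_div, inv_pow, ← Real.rpow_natCast, ← Real.rpow_neg hN.le]
    refine Real.rpow_le_rpow_of_exponent_le (by linarith [(Nat.cast_nonneg n : (0 : ℝ) ≤ n)]) ?_
    push_cast
    linarith

end Expansion

/-! ### Transition operators and geometric ergodicity in √V. -/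

section KernelTheory

variable {Z : Type*} [MeasurableSpace Z]

instance isMarkovKernel_pow (κ : Kernel Z Z) [IsMarkovKernel κ] (n : ℕ) :
    IsMarkovKernel (κ ^ n) := by
  induction n with
  | zero => rw [pow_zero]; exact inferInstanceAs (IsMarkovKernel Kernel.id)
  | succ n ih => rw [pow_succ]; exact inferInstanceAs (IsMarkovKernel ((κ ^ n) ∘ₖ κ))

/-- A measurable function dominated by `c √V`. -/
structure IsSqrtBdd (V : Z → ℝ) (c : ℝ) (g : Z → ℝ) : Prop where
  measurable : Measurable g
  nonneg : 0 ≤ c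
  abs_le : ∀ z, |g z| ≤ c * √(V z)

variable {V : Z → ℝ} {c c' : ℝ} {g g' : Z → ℝ}

theorem IsSqrtBdd.mono (hg : IsSqrtBdd V c g) (h : c ≤ c') : IsSqrtBdd V c' g :=
  ⟨hg.measurable, hg.nonneg.trans h, fun z => (hg.abs_le z).trans
    (mul_le_mul_of_nonneg_right h (Real.sqrt_nonneg _))⟩

theorem IsSqrtBdd.sub (hg : IsSqrtBdd V c g) (hg' : IsSqrtBdd V c' g') :
    IsSqrtBdd V (c + c') fun z => g z - g' z :=
  ⟨hg.measurable.sub hg'.measurable, add_nonneg hg.nonneg hg'.nonneg, fun z => by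
    rw [add_mul]; exact (abs_sub _ _).trans (add_le_add (hg.abs_le z) (hg'.abs_le z))⟩

theorem IsSqrtBdd.abs_le_mul (hg : IsSqrtBdd V c g) (hV : ∀ z, 1 ≤ V z) (z : Z) :
    |g z| ≤ c * V z :=
  (hg.abs_le z).trans (mul_le_mul_of_nonneg_left
    (Real.sqrt_le_iff.2 ⟨by linarith [hV z], by nlinarith [hV z]⟩) hg.nonneg)

theorem IsSqrtBdd.abs_mul_le (hg : IsSqrtBdd V c g) (hg' : IsSqrtBdd V c' g')
    (hV : ∀ z, 1 ≤ V z) (z : Z) : |g z * g' z| ≤ c * c' * V z := by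
  rw [abs_mul]
  calc |g z| * |g' z| ≤ (c * √(V z)) * (c' * √(V z)) :=
        mul_le_mul (hg.abs_le z) (hg'.abs_le z) (abs_nonneg _)
          (mul_nonneg hg.nonneg (Real.sqrt_nonneg _))
    _ = c * c' * (√(V z) * √(V z)) := by ring
    _ = c * c' * V z := by rw [Real.mul_self_sqrt (by linarith [hV z])]

theorem memLV_of_abs_le (hV : ∀ z, 1 ≤ V z) (hg : Measurable g) (h : ∀ z, |g z| ≤ c * V z) :
    MemLV V g :=
  ⟨hg, ⟨c, by
    rintro _ ⟨z, rfl⟩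
    exact (div_le_iff₀ (by linarith [hV z])).2 (h z)⟩⟩

theorem normV_le_of_abs_le {Z : Type*} [Nonempty Z] {V g : Z → ℝ} {c : ℝ}
    (hV : ∀ z, 1 ≤ V z) (h : ∀ z, |g z| ≤ c * V z) :
    normV V g ≤ c :=
  ciSup_le fun z => (div_le_iff₀ (by linarith [hV z])).2 (h z)

theorem IsSqrtBdd.memLV (hg : IsSqrtBdd V c g) (hV : ∀ z, 1 ≤ V z) : MemLV V g :=
  memLV_of_abs_le hV hg.measurable (hg.abs_le_mul hV)

theorem IsSqrtBdd.memLV_sq (hg : IsSqrtBdd V c g) (hV : ∀ z, 1 ≤ V z) :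
    MemLV V fun z => g z ^ 2 :=
  memLV_of_abs_le hV (hg.measurable.pow_const 2) fun z => by
    rw [pow_two]; exact hg.abs_mul_le hg hV z

theorem MemLV.exists_abs_le (hg : MemLV V g) (hV : ∀ z, 1 ≤ V z) :
    ∃ b : ℝ, 0 ≤ b ∧ ∀ z, |g z| ≤ b * V z := by
  obtain ⟨b, hb⟩ := hg.bddAbove
  refine ⟨max b 0, le_max_right _ _, fun z => ?_⟩
  have hz : 0 < V z := by linarith [hV z]
  exact (div_le_iff₀ hz).1 ((hb ⟨z, rfl⟩).trans (le_max_left _ _))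

theorem exists_isSqrtBdd_of_memLV_sq (hV : ∀ z, 1 ≤ V z) (hg : Measurable g)
    (h : MemLV V fun z => g z ^ 2) : ∃ c, IsSqrtBdd V c g := by
  obtain ⟨b, hb0, hb⟩ := h.exists_abs_le hV
  refine ⟨√b, hg, Real.sqrt_nonneg _, fun z => ?_⟩
  rw [← Real.sqrt_mul hb0, ← Real.sqrt_sq_eq_abs]
  exact Real.sqrt_le_sqrt ((le_abs_self _).trans (hb z))

theorem integrable_of_abs_le {ν : Measure Z} (hVi : Integrable V ν)
    (hg : Measurable g) (h : ∀ z, |g z| ≤ c * V z) : Integrable g ν :=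
  (hVi.const_mul c).mono' hg.aestronglyMeasurable (Eventually.of_forall h)

theorem IsSqrtBdd.integrable (hg : IsSqrtBdd V c g) (hV : ∀ z, 1 ≤ V z) {ν : Measure Z}
    (hVi : Integrable V ν) : Integrable g ν :=
  integrable_of_abs_le hVi hg.measurable (hg.abs_le_mul hV)

theorem IsSqrtBdd.integrable_mul (hg : IsSqrtBdd V c g) (hg' : IsSqrtBdd V c' g')
    (hV : ∀ z, 1 ≤ V z) {ν : Measure Z} (hVi : Integrable V ν) :
    Integrable (fun z => g z * g' z) ν :=
  integrable_of_abs_le hVi (hg.measurable.mul hg'.measurable) (hg.abs_mul_le hg' hV)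

theorem abs_integral_mul_le {ν : Measure Z} (hg : IsSqrtBdd V c g) (hg' : IsSqrtBdd V c' g')
    (hV : ∀ z, 1 ≤ V z) (hVi : Integrable V ν) :
    |∫ z, g z * g' z ∂ν| ≤ c * c' * ∫ z, V z ∂ν := by
  rw [← integral_const_mul]
  exact abs_integral_le_integral_abs.trans (integral_mono
    (hg.integrable_mul hg' hV hVi).abs (hVi.const_mul _) (hg.abs_mul_le hg' hV))

/-- The `n`-step transition operator. -/
def iter (κ : Kernel Z Z) (n : ℕ) (g : Z → ℝ) (z : Z) : ℝ := ∫ y, g y ∂((κ ^ n) z)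

variable {κ : Kernel Z Z} {π : Measure Z}

theorem measurable_iter (hg : Measurable g) (n : ℕ) : Measurable (iter κ n g) :=
  hg.stronglyMeasurable.integral_kernel.measurable

theorem iter_zero (hg : Measurable g) : iter κ 0 g = g := by
  funext z
  rw [iter, pow_zero]
  exact integral_dirac' g z hg.stronglyMeasurable

theorem iter_one : iter κ 1 g = fun z => ∫ y, g y ∂(κ z) := by
  funext z
  rw [iter, pow_one]

theorem iter_add {m n : ℕ} {z : Z} (hg : Integrable g ((κ ^ (m + n)) z)) :
    iter κ (m + n) g z = iter κ n (iter κ m g) z := by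
  rw [iter, pow_add κ m n]
  rw [pow_add κ m n] at hg
  exact Kernel.integral_comp hg

theorem comp_pow_eq (hinv : κ.Invariant π) (n : ℕ) : (κ ^ n) ∘ₘ π = π := by
  induction n with
  | zero => rw [pow_zero]; exact Measure.id_comp
  | succ n ih =>
    rw [pow_succ]
    change ((κ ^ n) ∘ₖ κ) ∘ₘ π = π
    rw [← Measure.comp_assoc, hinv.def, ih]

section Stationary

variable [IsMarkovKernel κ] [IsProbabilityMeasure π]

theorem integrable_snd {n : ℕ} (hinv : κ.Invariant π) (hgi : Integrable g π) :
    Integrable (fun p : Z × Z => g p.2) (π ⊗ₘ (κ ^ n)) := by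
  have h : (π ⊗ₘ (κ ^ n)).map Prod.snd = π := by
    have := Measure.snd_compProd π (κ ^ n)
    rwa [comp_pow_eq hinv n] at this
  rw [← h] at hgi
  exact hgi.comp_measurable measurable_snd

theorem integral_snd {n : ℕ} (hinv : κ.Invariant π) (hg : Measurable g) :
    ∫ p, g p.2 ∂(π ⊗ₘ (κ ^ n)) = ∫ z, g z ∂π := by
  have h : (π ⊗ₘ (κ ^ n)).map Prod.snd = π := by
    have := Measure.snd_compProd π (κ ^ n)
    rwa [comp_pow_eq hinv n] at this
  conv_rhs => rw [← h]
  rw [integral_map measurable_snd.aemeasurable hg.aestronglyMeasurable]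

theorem map_fst_compProd (n : ℕ) : (π ⊗ₘ (κ ^ n)).map Prod.fst = π :=
  Measure.fst_compProd π (κ ^ n)

theorem integrable_fst {n : ℕ} (hgi : Integrable g π) :
    Integrable (fun p : Z × Z => g p.1) (π ⊗ₘ (κ ^ n)) := by
  rw [← map_fst_compProd (κ := κ) (π := π) n] at hgi
  exact hgi.comp_measurable measurable_fst

theorem integral_fst {n : ℕ} (hg : Measurable g) :
    ∫ p, g p.1 ∂(π ⊗ₘ (κ ^ n)) = ∫ z, g z ∂π := by
  conv_rhs => rw [← map_fst_compProd (κ := κ) (π := π) n]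
  rw [integral_map measurable_fst.aemeasurable hg.aestronglyMeasurable]

theorem integrable_fst_mul_snd {n : ℕ} (hinv : κ.Invariant π)
    (hV : ∀ z, 1 ≤ V z) (hVi : Integrable V π) (hg : IsSqrtBdd V c g) (hg' : IsSqrtBdd V c' g') :
    Integrable (fun p : Z × Z => g p.1 * g' p.2) (π ⊗ₘ (κ ^ n)) := by
  have h := ((integrable_fst (κ := κ) (n := n) hVi).add
    (integrable_snd (n := n) hinv hVi)).const_mul (c * c')
  refine h.mono' (((hg.measurable.comp measurable_fst).mul
    (hg'.measurable.comp measurable_snd)).aestronglyMeasurable) (Eventually.of_forall fun p => ?_)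
  have h1 : 0 ≤ V p.1 := by linarith [hV p.1]
  have h2 : 0 ≤ V p.2 := by linarith [hV p.2]
  have h3 : √(V p.1) * √(V p.2) ≤ V p.1 + V p.2 := by
    nlinarith [Real.sq_sqrt h1, Real.sq_sqrt h2, sq_nonneg (√(V p.1) - √(V p.2))]
  rw [Real.norm_eq_abs, abs_mul]
  calc |g p.1| * |g' p.2| ≤ (c * √(V p.1)) * (c' * √(V p.2)) :=
        mul_le_mul (hg.abs_le _) (hg'.abs_le _) (abs_nonneg _)
          (mul_nonneg hg.nonneg (Real.sqrt_nonneg _))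
    _ = c * c' * (√(V p.1) * √(V p.2)) := by ring
    _ ≤ c * c' * (V p.1 + V p.2) :=
        mul_le_mul_of_nonneg_left h3 (mul_nonneg hg.nonneg hg'.nonneg)

theorem integral_fst_mul_snd {n : ℕ} (hinv : κ.Invariant π)
    (hV : ∀ z, 1 ≤ V z) (hVi : Integrable V π) (hg : IsSqrtBdd V c g) (hg' : IsSqrtBdd V c' g') :
    ∫ p, g p.1 * g' p.2 ∂(π ⊗ₘ (κ ^ n)) = ∫ z, g z * iter κ n g' z ∂π := by
  rw [Measure.integral_compProd (integrable_fst_mul_snd hinv hV hVi hg hg')]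
  simp only [integral_const_mul, iter]

theorem integral_iter {n : ℕ} (hinv : κ.Invariant π) (hg : Measurable g) (hgi : Integrable g π) :
    ∫ z, iter κ n g z ∂π = ∫ z, g z ∂π := by
  rw [← integral_snd (n := n) hinv hg, Measure.integral_compProd (integrable_snd hinv hgi)]
  rfl

end Stationary

/-- `V`-uniform ergodicity implies `√V`-uniform ergodicity. -/
theorem IsVUniformlyErgodic.exists_sqrt [IsMarkovKernel κ] [IsProbabilityMeasure π]
    (h : IsVUniformlyErgodic κ π V) (hVm : Measurable V) (hV : ∀ z, 1 ≤ V z) :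
    ∃ r B : ℝ, 0 < r ∧ r < 1 ∧ 0 ≤ B ∧
      (∀ (c : ℝ) (g : Z → ℝ), IsSqrtBdd V c g → ∀ n z,
        |iter κ n g z - ∫ y, g y ∂π| ≤ B * c * r ^ n * √(V z)) ∧
      ∀ (c : ℝ) (g : Z → ℝ), 0 ≤ c → Measurable g → (∀ z, |g z| ≤ c * V z) → ∀ n z,
        |iter κ n g z - ∫ y, g y ∂π| ≤ B * c * r ^ n * V z := by
  obtain ⟨ρ, hρ0, hρ1, B, hB⟩ := h.ergodic
  have hne : Nonempty Z := nonempty_of_isProbabilityMeasure π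
  have hB0 : ∀ (c : ℝ) (g : Z → ℝ), 0 ≤ c → Measurable g → (∀ z, |g z| ≤ c * V z) → ∀ n z,
      |iter κ n g z - ∫ y, g y ∂π| ≤ max B 0 * c * ρ ^ n * V z := by
    intro c g hc hg hgV n z
    have hz : 0 ≤ V z := by linarith [hV z]
    refine (hB g (memLV_of_abs_le hV hg hgV) z n).trans ?_
    have h0 : 0 ≤ normV V g := Real.iSup_nonneg fun z => div_nonneg (abs_nonneg _)
      (by linarith [hV z])
    have h1 : B * normV V g ≤ max B 0 * c :=
      (mul_le_mul_of_nonneg_right (le_max_left _ _) h0).trans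
        (mul_le_mul_of_nonneg_left (normV_le_of_abs_le hV hgV) (le_max_right _ _))
    exact mul_le_mul_of_nonneg_right (mul_le_mul_of_nonneg_right h1 (by positivity)) hz
  have hr1 : √ρ < 1 := by rw [Real.sqrt_lt' one_pos]; simpa using hρ1
  have hρr : ρ ≤ √ρ := by
    have := Real.sq_sqrt hρ0.le
    have := Real.sqrt_nonneg ρ
    nlinarith
  refine ⟨√ρ, max B 0 + 2, Real.sqrt_pos.2 hρ0, hr1, by positivity, ?_, ?_⟩
  · intro c g hg n z
    have hz : 0 < V z := by linarith [hV z]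
    -- Truncating at the level V ≤ T balances the two errors. The low part is at most c √T and is
    -- bounded trivially under both laws; the high part satisfies |g| ≤ c √V ≤ (c/√T) V, so
    -- V-ergodicity bounds its error by B (c/√T) T. Both are multiples of √T = √ρⁿ √V(z).
    set T : ℝ := ρ ^ n * V z with hT
    have hT0 : 0 < T := by positivity
    have hsT : √T = √ρ ^ n * √(V z) := by
      have : ρ ^ n = (√ρ ^ n) ^ 2 := by rw [← pow_mul, mul_comm, pow_mul, Real.sq_sqrt hρ0.le]
      rw [hT, Real.sqrt_mul (by positivity), this, Real.sqrt_sq (by positivity)]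
    have hsT0 : 0 < √T := Real.sqrt_pos.2 hT0
    have hms : MeasurableSet {y | V y ≤ T} := measurableSet_le hVm measurable_const
    set g1 : Z → ℝ := {y | V y ≤ T}.indicator g with hg1
    set g2 : Z → ℝ := {y | V y ≤ T}ᶜ.indicator g with hg2
    have hsplit : ∀ y, g y = g1 y + g2 y := fun y =>
      (congrFun (Set.indicator_self_add_compl {y | V y ≤ T} g) y).symm
    have hm1 : Measurable g1 := hg.measurable.indicator hms
    have hm2 : Measurable g2 := hg.measurable.indicator hms.compl
    have hc := hg.nonneg
    have hb1 : ∀ y, |g1 y| ≤ c * √T := by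
      intro y
      by_cases hy : V y ≤ T
      · rw [hg1, Set.indicator_of_mem (by exact hy)]
        exact (hg.abs_le y).trans (mul_le_mul_of_nonneg_left (Real.sqrt_le_sqrt hy) hc)
      · rw [hg1, Set.indicator_of_notMem (by exact hy), abs_zero]; positivity
    have hb2 : ∀ y, |g2 y| ≤ c / √T * V y := by
      intro y
      have hVy : 0 < V y := by linarith [hV y]
      by_cases hy : V y ≤ T
      · rw [hg2, Set.indicator_of_notMem (by simpa using hy), abs_zero]; positivity
      · rw [hg2, Set.indicator_of_mem (by simpa using hy)]
        refine (hg.abs_le y).trans ?_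
        rw [div_mul_eq_mul_div, le_div_iff₀ hsT0, mul_assoc]
        refine mul_le_mul_of_nonneg_left ?_ hc
        calc √(V y) * √T ≤ √(V y) * √(V y) :=
              mul_le_mul_of_nonneg_left (Real.sqrt_le_sqrt (not_le.1 hy).le) (Real.sqrt_nonneg _)
          _ = V y := Real.mul_self_sqrt hVy.le
    have hint1 : ∀ (ν : Measure Z) [IsProbabilityMeasure ν], Integrable g1 ν ∧
        |∫ y, g1 y ∂ν| ≤ c * √T := by
      intro ν _
      refine ⟨(integrable_const (c * √T)).mono' hm1.aestronglyMeasurable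
        (Eventually.of_forall hb1), ?_⟩
      have := norm_integral_le_of_norm_le_const (μ := ν) (f := g1) (Eventually.of_forall hb1)
      simpa using this
    have hi : iter κ n g z = iter κ n g1 z + iter κ n g2 z := by
      simp only [iter]
      rw [← integral_add (hint1 _).1 (integrable_of_abs_le (h.integrable_pow n z) hm2 hb2)]
      simp only [hsplit]
    have hi' : ∫ y, g y ∂π = ∫ y, g1 y ∂π + ∫ y, g2 y ∂π := by
      rw [← integral_add (hint1 _).1 (integrable_of_abs_le h.integrable_inv hm2 hb2)]
      simp only [hsplit]
    have k2 := hB0 (c / √T) g2 (by positivity) hm2 hb2 n z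
    have k2' : max B 0 * (c / √T) * ρ ^ n * V z = max B 0 * c * √T := by
      have : ρ ^ n * V z = √T * √T := by rw [Real.mul_self_sqrt hT0.le]
      rw [mul_assoc _ (ρ ^ n), this]
      field_simp
    rw [k2'] at k2
    have k1 : |iter κ n g1 z| ≤ c * √T := (hint1 ((κ ^ n) z)).2
    have k1' := (hint1 π).2
    rw [hi, hi', mul_assoc, ← hsT]
    calc |iter κ n g1 z + iter κ n g2 z - (∫ y, g1 y ∂π + ∫ y, g2 y ∂π)|
        = |iter κ n g1 z + -(∫ y, g1 y ∂π) + (iter κ n g2 z - ∫ y, g2 y ∂π)| := by ring_nf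
      _ ≤ |iter κ n g1 z| + |-(∫ y, g1 y ∂π)| + |iter κ n g2 z - ∫ y, g2 y ∂π| :=
          (abs_add_le _ _).trans (add_le_add (abs_add_le _ _) le_rfl)
      _ ≤ c * √T + c * √T + max B 0 * c * √T := by rw [abs_neg]; gcongr
      _ = _ := by ring
  · intro c g hc hg hgV n z
    have hz : 0 ≤ V z := by linarith [hV z]
    refine (hB0 c g hc hg hgV n z).trans ?_
    have : ρ ^ n ≤ √ρ ^ n := pow_le_pow_left₀ hρ0.le hρr n
    have h2 : max B 0 ≤ max B 0 + 2 := by linarith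
    gcongr

end KernelTheory

/-! ### Poisson's equation. -/

section Poisson

variable {Z : Type*} [MeasurableSpace Z]

/-- `V`-uniform and `√V`-uniform ergodicity with explicit constants. -/
structure IsSqrtErgodic (κ : Kernel Z Z) (π : Measure Z) (V : Z → ℝ) (r B : ℝ) : Prop where
  one_le : ∀ z, 1 ≤ V z
  invariant : κ.Invariant π
  integrable_pow : ∀ (n : ℕ) (z : Z), Integrable V ((κ ^ n) z)
  integrable_inv : Integrable V π
  rate_pos : 0 < r
  rate_lt_one : r < 1
  const_nonneg : 0 ≤ B
  sqrt_ergodic : ∀ (c : ℝ) (g : Z → ℝ), IsSqrtBdd V c g → ∀ n z,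
    |iter κ n g z - ∫ y, g y ∂π| ≤ B * c * r ^ n * √(V z)
  ergodic : ∀ (c : ℝ) (g : Z → ℝ), 0 ≤ c → Measurable g → (∀ z, |g z| ≤ c * V z) → ∀ n z,
    |iter κ n g z - ∫ y, g y ∂π| ≤ B * c * r ^ n * V z

/-- The solution `∑ₖ Pᵏ g` of Poisson's equation. -/
def poissonSum (κ : Kernel Z Z) (g : Z → ℝ) (z : Z) : ℝ := ∑' k, iter κ k g z

variable {κ : Kernel Z Z} {π : Measure Z} {V : Z → ℝ} {r B c c' : ℝ} {g g' : Z → ℝ}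

theorem IsSqrtErgodic.isSqrtBdd_iter (h : IsSqrtErgodic κ π V r B) (hg : IsSqrtBdd V c g)
    (h0 : ∫ z, g z ∂π = 0) (n : ℕ) : IsSqrtBdd V (B * c * r ^ n) (iter κ n g) :=
  ⟨measurable_iter hg.measurable n,
    mul_nonneg (mul_nonneg h.const_nonneg hg.nonneg) (pow_nonneg h.rate_pos.le n), fun z => by
    simpa [h0] using h.sqrt_ergodic c g hg n z⟩

theorem IsSqrtErgodic.hasSum_geometric (h : IsSqrtErgodic κ π V r B) (b : ℝ) :
    HasSum (fun k : ℕ => b * r ^ k) (b / (1 - r)) := by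
  rw [div_eq_mul_inv]
  exact (hasSum_geometric_of_lt_one h.rate_pos.le h.rate_lt_one).mul_left b

theorem IsSqrtErgodic.hasSum_poissonSum (h : IsSqrtErgodic κ π V r B) (hg : IsSqrtBdd V c g)
    (h0 : ∫ z, g z ∂π = 0) (z : Z) : HasSum (fun k => iter κ k g z) (poissonSum κ g z) := by
  refine Summable.hasSum (Summable.of_norm_bounded
    (h.hasSum_geometric (B * c * √(V z))).summable fun k => ?_)
  refine ((h.isSqrtBdd_iter hg h0 k).abs_le z).trans (le_of_eq ?_)
  ring

theorem IsSqrtErgodic.isSqrtBdd_poissonSum (h : IsSqrtErgodic κ π V r B) (hg : IsSqrtBdd V c g)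
    (h0 : ∫ z, g z ∂π = 0) : IsSqrtBdd V (B * c / (1 - r)) (poissonSum κ g) := by
  refine ⟨Measurable.tsum fun k => measurable_iter hg.measurable k,
    div_nonneg (mul_nonneg h.const_nonneg hg.nonneg) (by linarith [h.rate_lt_one]), fun z => ?_⟩
  have e : B * c / (1 - r) * √(V z) = B * c * √(V z) / (1 - r) := by ring
  rw [e]
  rw [← Real.norm_eq_abs]
  refine tsum_of_norm_bounded (h.hasSum_geometric (B * c * √(V z))) fun k => ?_
  refine ((h.isSqrtBdd_iter hg h0 k).abs_le z).trans (le_of_eq ?_)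
  ring

/-- The terms are dominated by geometric multiples of V, so summation and integration commute for
every measure that integrates V. -/
theorem IsSqrtErgodic.hasSum_integral_poissonSum (h : IsSqrtErgodic κ π V r B)
    (hg : IsSqrtBdd V c g) (h0 : ∫ z, g z ∂π = 0) {ν : Measure Z} (hν : Integrable V ν) :
    HasSum (fun k => ∫ z, iter κ k g z ∂ν) (∫ z, poissonSum κ g z ∂ν) := by
  have hi := fun k => (h.isSqrtBdd_iter hg h0 k).integrable h.one_le hν
  refine hasSum_integral_of_summable_integral_norm hi ?_
  refine Summable.of_nonneg_of_le (fun k => integral_nonneg fun z => norm_nonneg _) (fun k => ?_)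
    (h.hasSum_geometric (B * c * ∫ z, V z ∂ν)).summable
  have := integral_mono (hi k).norm (hν.const_mul (B * c * r ^ k))
    ((h.isSqrtBdd_iter hg h0 k).abs_le_mul h.one_le)
  rw [integral_const_mul] at this
  refine this.trans (le_of_eq (by ring))

theorem IsSqrtErgodic.integral_poissonSum [IsMarkovKernel κ] [IsProbabilityMeasure π]
    (h : IsSqrtErgodic κ π V r B) (hg : IsSqrtBdd V c g) (h0 : ∫ z, g z ∂π = 0) :
    ∫ z, poissonSum κ g z ∂π = 0 := by
  have h1 := h.hasSum_integral_poissonSum hg h0 h.integrable_inv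
  simp only [integral_iter h.invariant hg.measurable (hg.integrable h.one_le h.integrable_inv),
    h0] at h1
  exact h1.unique hasSum_zero

/-- Applying P shifts the series by one term, so exactly the term k = 0 is lost. -/
theorem IsSqrtErgodic.iter_one_poissonSum (h : IsSqrtErgodic κ π V r B) (hg : IsSqrtBdd V c g)
    (h0 : ∫ z, g z ∂π = 0) (z : Z) :
    iter κ 1 (poissonSum κ g) z = poissonSum κ g z - g z := by
  have h1 := h.hasSum_integral_poissonSum hg h0 (h.integrable_pow 1 z)
  have h2 : HasSum (fun k => iter κ (k + 1) g z) (iter κ 1 (poissonSum κ g) z) := by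
    refine h1.congr_fun ?_
    intro k
    exact iter_add (hg.integrable h.one_le (h.integrable_pow _ z))
  have h3 := (hasSum_nat_add_iff' 1).2 (h.hasSum_poissonSum hg h0 z)
  simp only [Finset.sum_range_one, iter_zero hg.measurable] at h3
  exact h2.unique h3

theorem iter_sub {n : ℕ} {z : Z} (hg : Integrable g ((κ ^ n) z))
    (hg' : Integrable g' ((κ ^ n) z)) :
    iter κ n (fun y => g y - g' y) z = iter κ n g z - iter κ n g' z :=
  integral_sub hg hg'

theorem IsSqrtErgodic.iter_poissonSum (h : IsSqrtErgodic κ π V r B) (hg : IsSqrtBdd V c g)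
    (h0 : ∫ z, g z ∂π = 0) (n : ℕ) (z : Z) :
    iter κ n (poissonSum κ g) z = iter κ (n + 1) (poissonSum κ g) z + iter κ n g z := by
  have hp := h.isSqrtBdd_poissonSum hg h0
  rw [add_comm n 1, iter_add (hp.integrable h.one_le (h.integrable_pow _ z)),
    funext (h.iter_one_poissonSum hg h0),
    iter_sub (hp.integrable h.one_le (h.integrable_pow _ z))
      (hg.integrable h.one_le (h.integrable_pow _ z))]
  ring

/-- g = Pⁿg converges to its mean. Only a bound by V is assumed, so uniqueness for Poisson's
equation holds in all of `MemLV V`. -/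
theorem IsSqrtErgodic.eq_zero_of_harmonic (h : IsSqrtErgodic κ π V r B) (hg : Measurable g)
    (hc : 0 ≤ c) (hgV : ∀ z, |g z| ≤ c * V z) (h0 : ∫ z, g z ∂π = 0)
    (hP : ∀ z, ∫ y, g y ∂(κ z) = g z) (z : Z) : g z = 0 := by
  have hn : ∀ n, iter κ n g z = g z := by
    intro n
    induction n with
    | zero => rw [iter_zero hg]
    | succ n ih =>
      rw [add_comm n 1, iter_add (integrable_of_abs_le (h.integrable_pow _ z) hg hgV), iter_one,
        funext hP, ih]
  have hb : ∀ n : ℕ, |g z| ≤ B * c * r ^ n * V z := by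
    intro n
    simpa [h0, hn n] using h.ergodic c g hc hg hgV n z
  have ht : Tendsto (fun n : ℕ => B * c * r ^ n * V z) atTop (𝓝 (B * c * 0 * V z)) :=
    ((tendsto_pow_atTop_nhds_zero_of_lt_one h.rate_pos.le h.rate_lt_one).const_mul _).mul_const _
  have := ge_of_tendsto' ht hb
  simpa using this

theorem IsSqrtErgodic.poisson_unique {d : ℕ} (h : IsSqrtErgodic κ π V r B)
    [IsMarkovKernel κ] {f h₁ h₂ : Z → Fin d → ℝ} (H₁ : IsPoissonSolution κ π V f h₁)
    (H₂ : IsPoissonSolution κ π V f h₂) : h₁ = h₂ := by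
  funext z i
  obtain ⟨b₁, hb₁0, hb₁⟩ := (H₁.memLV i).exists_abs_le h.one_le
  obtain ⟨b₂, hb₂0, hb₂⟩ := (H₂.memLV i).exists_abs_le h.one_le
  have hm₁ := (H₁.memLV i).measurable
  have hm₂ := (H₂.memLV i).measurable
  have := h.eq_zero_of_harmonic (g := fun z => h₁ z i - h₂ z i) (c := b₁ + b₂)
    (hm₁.sub hm₂) (add_nonneg hb₁0 hb₂0)
    (fun z => by
      rw [add_mul]; exact (abs_sub _ _).trans (add_le_add (hb₁ z) (hb₂ z)))
    (by
      rw [integral_sub (integrable_of_abs_le h.integrable_inv hm₁ hb₁)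
        (integrable_of_abs_le h.integrable_inv hm₂ hb₂), H₁.mean_zero, H₂.mean_zero, sub_zero])
    (fun z => by
      have hi := h.integrable_pow 1 z
      rw [pow_one] at hi
      rw [integral_sub (integrable_of_abs_le hi hm₁ hb₁) (integrable_of_abs_le hi hm₂ hb₂),
        H₁.poisson, H₂.poisson]
      ring) z
  linarith

end Poisson

/-! ### Second-moment matrices and martingale differences. -/

section SecondMoments

/-- The matrix of second moments `E[X Yᵀ]`. -/
def secondMoment {Ω : Type*} {_ : MeasurableSpace Ω} {d : ℕ} (μ : Measure Ω)
    (X Y : Ω → Fin d → ℝ) : Matrix (Fin d) (Fin d) ℝ :=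
  Matrix.of fun i j => ∫ ω, X ω i * Y ω j ∂μ

theorem secondMoment_transpose {Ω : Type*} {_ : MeasurableSpace Ω} {d : ℕ} (μ : Measure Ω)
    (X Y : Ω → Fin d → ℝ) : (secondMoment μ X Y)ᵀ = secondMoment μ Y X := by
  ext i j
  simp only [secondMoment, transpose_apply, of_apply, mul_comm]

theorem secondMoment_posSemidef {Ω : Type*} {_ : MeasurableSpace Ω} {d : ℕ} (μ : Measure Ω)
    (X : Ω → Fin d → ℝ) (hX : ∀ i j, Integrable (fun ω => X ω i * X ω j) μ) :
    (secondMoment μ X X).PosSemidef := by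
  refine Matrix.PosSemidef.of_dotProduct_mulVec_nonneg ?_ fun x => ?_
  · rw [Matrix.IsHermitian, conjTranspose_eq_transpose_of_trivial, secondMoment_transpose]
  · have : star x ⬝ᵥ secondMoment μ X X *ᵥ x = ∫ ω, (∑ i, x i * X ω i) ^ 2 ∂μ := by
      have e : ∀ ω, (∑ i, x i * X ω i) ^ 2 = ∑ i, ∑ j, x i * x j * (X ω i * X ω j) := by
        intro ω
        rw [pow_two, Finset.sum_mul_sum]
        exact Finset.sum_congr rfl fun i _ => Finset.sum_congr rfl fun j _ => by ring
      simp only [e]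
      rw [integral_finsetSum _ fun i _ => integrable_finsetSum _ fun j _ => (hX i j).const_mul _]
      simp only [dotProduct, mulVec, star_trivial, Finset.mul_sum]
      refine Finset.sum_congr rfl fun i _ => ?_
      rw [integral_finsetSum _ fun j _ => (hX i j).const_mul _]
      refine Finset.sum_congr rfl fun j _ => ?_
      rw [integral_const_mul, secondMoment, of_apply]
      ring
    rw [this]
    exact integral_nonneg fun ω => sq_nonneg _

variable {Z : Type*} [MeasurableSpace Z] {κ : Kernel Z Z} {π : Measure Z} {V : Z → ℝ}
  {r B c c' : ℝ} {d : ℕ}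

/-- The transition operator acting on vector-valued functions. -/
def viter (κ : Kernel Z Z) (n : ℕ) (f : Z → Fin d → ℝ) (z : Z) (i : Fin d) : ℝ :=
  iter κ n (fun y => f y i) z

/-- Covariance of two martingale differences, in terms of the stationary law. -/
theorem IsSqrtErgodic.crossCov_mdiff [IsMarkovKernel κ] [IsProbabilityMeasure π]
    (h : IsSqrtErgodic κ π V r B) {f g : Z → Fin d → ℝ}
    (hf : ∀ i, IsSqrtBdd V c fun z => f z i) (hf0 : ∀ i, ∫ z, f z i ∂π = 0)
    (hg : ∀ i, IsSqrtBdd V c' fun z => g z i) (hg0 : ∀ i, ∫ z, g z i ∂π = 0) :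
    crossCov κ π (mdiff κ f) (mdiff κ g)
        = secondMoment π f g - secondMoment π (viter κ 1 f) (viter κ 1 g) ∧
      crossCov κ π (mdiff κ f) (fun p => g p.2)
        = secondMoment π f g - secondMoment π (viter κ 1 f) (viter κ 1 g) ∧
      ∀ i j, Integrable (fun p => mdiff κ f p i * mdiff κ g p j) (π ⊗ₘ κ) := by
  have hV := h.one_le
  have hVi := h.integrable_inv
  have hinv := h.invariant
  have hPf := fun i => h.isSqrtBdd_iter (hf i) (hf0 i) 1
  have hPg := fun i => h.isSqrtBdd_iter (hg i) (hg0 i) 1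
  -- Written with κ ^ 1 so that the n-step lemmas apply; the power is simplified away afterwards.
  have i1 : ∀ i j, Integrable (fun p : Z × Z => f p.2 i * g p.2 j) (π ⊗ₘ (κ ^ 1)) := fun i j =>
    integrable_snd (g := fun z => f z i * g z j) hinv ((hf i).integrable_mul (hg j) hV hVi)
  have i2 : ∀ i j, Integrable (fun p : Z × Z => viter κ 1 f p.1 i * g p.2 j) (π ⊗ₘ (κ ^ 1)) :=
    fun i j => integrable_fst_mul_snd hinv hV hVi (hPf i) (hg j)
  have i3 : ∀ i j, Integrable (fun p : Z × Z => viter κ 1 g p.1 j * f p.2 i) (π ⊗ₘ (κ ^ 1)) :=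
    fun i j => integrable_fst_mul_snd hinv hV hVi (hPg j) (hf i)
  have i4 : ∀ i j, Integrable (fun p : Z × Z => viter κ 1 f p.1 i * viter κ 1 g p.1 j)
      (π ⊗ₘ (κ ^ 1)) := fun i j =>
    integrable_fst (g := fun z => viter κ 1 f z i * viter κ 1 g z j)
      ((hPf i).integrable_mul (hPg j) hV hVi)
  have e1 : ∀ i j, ∫ p : Z × Z, f p.2 i * g p.2 j ∂(π ⊗ₘ (κ ^ 1)) = ∫ z, f z i * g z j ∂π :=
    fun i j => integral_snd (g := fun z => f z i * g z j) hinv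
      ((hf i).measurable.mul (hg j).measurable)
  have e2 : ∀ i j, ∫ p : Z × Z, viter κ 1 f p.1 i * g p.2 j ∂(π ⊗ₘ (κ ^ 1))
      = ∫ z, viter κ 1 f z i * viter κ 1 g z j ∂π :=
    fun i j => integral_fst_mul_snd hinv hV hVi (hPf i) (hg j)
  have e3 : ∀ i j, ∫ p : Z × Z, viter κ 1 g p.1 j * f p.2 i ∂(π ⊗ₘ (κ ^ 1))
      = ∫ z, viter κ 1 g z j * viter κ 1 f z i ∂π :=
    fun i j => integral_fst_mul_snd hinv hV hVi (hPg j) (hf i)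
  have e4 : ∀ i j, ∫ p : Z × Z, viter κ 1 f p.1 i * viter κ 1 g p.1 j ∂(π ⊗ₘ (κ ^ 1))
      = ∫ z, viter κ 1 f z i * viter κ 1 g z j ∂π :=
    fun i j => integral_fst (g := fun z => viter κ 1 f z i * viter κ 1 g z j)
      ((hPf i).measurable.mul (hPg j).measurable)
  have hmd : ∀ (u : Z → Fin d → ℝ) p i, mdiff κ u p i = u p.2 i - viter κ 1 u p.1 i := by
    intro u p i
    rw [viter, iter_one, mdiff]
  have x1 : ∀ i j, (fun p : Z × Z => mdiff κ f p i * mdiff κ g p j) = fun p =>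
      (f p.2 i * g p.2 j - viter κ 1 f p.1 i * g p.2 j)
        - (viter κ 1 g p.1 j * f p.2 i - viter κ 1 f p.1 i * viter κ 1 g p.1 j) := by
    intro i j; funext p; rw [hmd, hmd]; ring
  have x2 : ∀ i j, (fun p : Z × Z => mdiff κ f p i * g p.2 j) = fun p =>
      f p.2 i * g p.2 j - viter κ 1 f p.1 i * g p.2 j := by
    intro i j; funext p; rw [hmd]; ring
  have hcomm : ∀ i j, ∫ z, viter κ 1 g z j * viter κ 1 f z i ∂π
      = ∫ z, viter κ 1 f z i * viter κ 1 g z j ∂π := fun i j => by simp only [mul_comm]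
  simp only [pow_one] at i1 i2 i3 i4 e1 e2 e3 e4
  have i12 : ∀ i j, Integrable (fun p : Z × Z => f p.2 i * g p.2 j - viter κ 1 f p.1 i * g p.2 j)
      (π ⊗ₘ κ) := fun i j => (i1 i j).sub (i2 i j)
  have i34 : ∀ i j, Integrable (fun p : Z × Z => viter κ 1 g p.1 j * f p.2 i
      - viter κ 1 f p.1 i * viter κ 1 g p.1 j) (π ⊗ₘ κ) := fun i j => (i3 i j).sub (i4 i j)
  refine ⟨?_, ?_, fun i j => ?_⟩
  · ext i j
    simp only [crossCov, of_apply, x1, Matrix.sub_apply, secondMoment]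
    rw [integral_sub (i12 i j) (i34 i j),
      integral_sub (i1 i j) (i2 i j), integral_sub (i3 i j) (i4 i j), e1, e2, e3, e4, hcomm]
    ring
  · ext i j
    simp only [crossCov, of_apply, x2, Matrix.sub_apply, secondMoment]
    rw [integral_sub (i1 i j) (i2 i j), e1, e2]
  · rw [x1]
    exact (i12 i j).sub (i34 i j)

end SecondMoments

/-! ### Stationary covariances in terms of the Poisson solutions. -/

section StationaryMoments

variable {Z : Type*} [MeasurableSpace Z] {κ : Kernel Z Z} {π : Measure Z} {V : Z → ℝ}
  {r B c c' : ℝ} {d : ℕ}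

/-- The zero-mean solution of Poisson's equation, coordinate by coordinate. -/
def vpoisson (κ : Kernel Z Z) (f : Z → Fin d → ℝ) (z : Z) (i : Fin d) : ℝ :=
  poissonSum κ (fun y => f y i) z

theorem IsSqrtErgodic.isSqrtBdd_vpoisson (h : IsSqrtErgodic κ π V r B) {f : Z → Fin d → ℝ}
    (hf : ∀ i, IsSqrtBdd V c fun z => f z i) (hf0 : ∀ i, ∫ z, f z i ∂π = 0) (i : Fin d) :
    IsSqrtBdd V (B * c / (1 - r)) fun z => vpoisson κ f z i :=
  h.isSqrtBdd_poissonSum (hf i) (hf0 i)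

theorem IsSqrtErgodic.integral_vpoisson [IsMarkovKernel κ] [IsProbabilityMeasure π]
    (h : IsSqrtErgodic κ π V r B) {f : Z → Fin d → ℝ}
    (hf : ∀ i, IsSqrtBdd V c fun z => f z i) (hf0 : ∀ i, ∫ z, f z i ∂π = 0) (i : Fin d) :
    ∫ z, vpoisson κ f z i ∂π = 0 :=
  h.integral_poissonSum (hf i) (hf0 i)

theorem IsSqrtErgodic.isSqrtBdd_viter (h : IsSqrtErgodic κ π V r B) {f : Z → Fin d → ℝ}
    (hf : ∀ i, IsSqrtBdd V c fun z => f z i) (hf0 : ∀ i, ∫ z, f z i ∂π = 0) (n : ℕ) (i : Fin d) :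
    IsSqrtBdd V (B * c * r ^ n) fun z => viter κ n f z i :=
  h.isSqrtBdd_iter (hf i) (hf0 i) n

theorem viter_zero {f : Z → Fin d → ℝ} (hf : ∀ i, Measurable fun z => f z i) :
    viter κ 0 f = f := by
  funext z i
  exact congrFun (iter_zero (hf i)) z

theorem IsSqrtErgodic.viter_one_vpoisson (h : IsSqrtErgodic κ π V r B) {f : Z → Fin d → ℝ}
    (hf : ∀ i, IsSqrtBdd V c fun z => f z i) (hf0 : ∀ i, ∫ z, f z i ∂π = 0) :
    viter κ 1 (vpoisson κ f) = fun z i => vpoisson κ f z i - f z i := by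
  funext z i
  exact h.iter_one_poissonSum (hf i) (hf0 i) z

theorem IsSqrtErgodic.isPoissonSolution_vpoisson [IsMarkovKernel κ] [IsProbabilityMeasure π]
    (h : IsSqrtErgodic κ π V r B) {f : Z → Fin d → ℝ}
    (hf : ∀ i, IsSqrtBdd V c fun z => f z i) (hf0 : ∀ i, ∫ z, f z i ∂π = 0) :
    IsPoissonSolution κ π V f (vpoisson κ f) where
  memLV i := (h.isSqrtBdd_poissonSum (hf i) (hf0 i)).memLV h.one_le
  mean_zero i := h.integral_poissonSum (hf i) (hf0 i)
  poisson z i := by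
    rw [← congrFun (congrFun (h.viter_one_vpoisson hf hf0) z) i, viter, iter_one]

theorem IsSqrtErgodic.abs_secondMoment_viter_le (h : IsSqrtErgodic κ π V r B)
    {u g : Z → Fin d → ℝ} (hu : ∀ i, IsSqrtBdd V c fun z => u z i)
    (hg : ∀ i, IsSqrtBdd V c' fun z => g z i) (hg0 : ∀ i, ∫ z, g z i ∂π = 0) (k : ℕ)
    (i j : Fin d) :
    |secondMoment π u (viter κ k g) i j| ≤ c * (B * c') * (∫ z, V z ∂π) * r ^ k :=
  (abs_integral_mul_le (hu i) (h.isSqrtBdd_iter (hg j) (hg0 j) k) h.one_le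
    h.integrable_inv).trans (le_of_eq (by ring))

/-- Poisson's equation integrated against u. It is the source of both difference equations in k
needed by `lag_expansion`, and of the telescoping of the autocovariance series. -/
theorem IsSqrtErgodic.secondMoment_viter_vpoisson (h : IsSqrtErgodic κ π V r B)
    [IsMarkovKernel κ] [IsProbabilityMeasure π]
    {u g : Z → Fin d → ℝ} (hu : ∀ i, IsSqrtBdd V c fun z => u z i)
    (hg : ∀ i, IsSqrtBdd V c' fun z => g z i) (hg0 : ∀ i, ∫ z, g z i ∂π = 0) (k : ℕ) :
    secondMoment π u (viter κ k (vpoisson κ g)) =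
      secondMoment π u (viter κ (k + 1) (vpoisson κ g)) + secondMoment π u (viter κ k g) := by
  ext i j
  have hp := h.isSqrtBdd_vpoisson hg hg0
  have hp0 := h.integral_vpoisson hg hg0
  simp only [secondMoment, of_apply, Matrix.add_apply]
  rw [← integral_add ((hu i).integrable_mul (h.isSqrtBdd_viter hp hp0 (k + 1) j) h.one_le
    h.integrable_inv) ((hu i).integrable_mul (h.isSqrtBdd_viter hg hg0 k j) h.one_le
    h.integrable_inv)]
  refine integral_congr_ae (Eventually.of_forall fun z => ?_)
  change u z i * iter κ k (poissonSum κ fun y => g y j) z = _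
  rw [h.iter_poissonSum (hg j) (hg0 j), mul_add]
  rfl

/-- Used when u₁, u₂ solve Poisson's equations with forcing v₁, v₂: then uᵢ - vᵢ is P uᵢ, and the
left side is the covariance of two martingale differences. -/
theorem secondMoment_sub_secondMoment {u₁ u₂ v₁ v₂ : Z → Fin d → ℝ} (hV : ∀ z, 1 ≤ V z)
    (hVi : Integrable V π) {c₁ c₂ c₃ c₄ : ℝ}
    (hu₁ : ∀ i, IsSqrtBdd V c₁ fun z => u₁ z i) (hu₂ : ∀ i, IsSqrtBdd V c₂ fun z => u₂ z i)
    (hv₁ : ∀ i, IsSqrtBdd V c₃ fun z => v₁ z i) (hv₂ : ∀ i, IsSqrtBdd V c₄ fun z => v₂ z i) :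
    secondMoment π u₁ u₂
        - secondMoment π (fun z i => u₁ z i - v₁ z i) (fun z i => u₂ z i - v₂ z i) =
      secondMoment π u₁ v₂ + secondMoment π v₁ (fun z i => u₂ z i - v₂ z i) := by
  ext i j
  simp only [secondMoment, of_apply, Matrix.sub_apply, Matrix.add_apply]
  rw [← integral_sub ((hu₁ i).integrable_mul (hu₂ j) hV hVi)
      (((hu₁ i).sub (hv₁ i)).integrable_mul ((hu₂ j).sub (hv₂ j)) hV hVi),
    ← integral_add ((hu₁ i).integrable_mul (hv₂ j) hV hVi)
      ((hv₁ i).integrable_mul ((hu₂ j).sub (hv₂ j)) hV hVi)]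
  refine integral_congr_ae (Eventually.of_forall fun z => ?_)
  simp only
  ring

variable [IsMarkovKernel κ] [IsProbabilityMeasure π]

theorem IsSqrtErgodic.autocov_natCast (h : IsSqrtErgodic κ π V r B) {f : Z → Fin d → ℝ}
    (hf : ∀ i, IsSqrtBdd V c fun z => f z i) (k : ℕ) (i j : Fin d) :
    autocov κ π f k i j = secondMoment π f (viter κ k f) j i := by
  simp only [autocov, of_apply, Int.natCast_nonneg, if_true, Int.toNat_natCast]
  simp only [mul_comm (f (Prod.snd _) i)]
  exact integral_fst_mul_snd h.invariant h.one_le h.integrable_inv (hf j) (hf i)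

theorem IsSqrtErgodic.autocov_neg (h : IsSqrtErgodic κ π V r B) {f : Z → Fin d → ℝ}
    (hf : ∀ i, IsSqrtBdd V c fun z => f z i) (k : ℕ) (i j : Fin d) :
    autocov κ π f (-((k : ℤ) + 1)) i j = secondMoment π f (viter κ (k + 1) f) i j := by
  have h1 : ¬ (0 : ℤ) ≤ -((k : ℤ) + 1) := by omega
  have h2 : (- -((k : ℤ) + 1)).toNat = k + 1 := by omega
  simp only [autocov, of_apply, h1, if_false, h2]
  exact integral_fst_mul_snd h.invariant h.one_le h.integrable_inv (hf i) (hf j)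

/-- The partial sums telescope, and the boundary term at lag m + n tends to 0 geometrically. -/
theorem IsSqrtErgodic.hasSum_secondMoment (h : IsSqrtErgodic κ π V r B) {f : Z → Fin d → ℝ}
    (hf : ∀ i, IsSqrtBdd V c fun z => f z i) (hf0 : ∀ i, ∫ z, f z i ∂π = 0) (m : ℕ)
    (i j : Fin d) :
    HasSum (fun k => secondMoment π f (viter κ (m + k) f) i j)
      (secondMoment π f (viter κ m (vpoisson κ f)) i j) := by
  have hp := h.isSqrtBdd_vpoisson hf hf0
  have hp0 := h.integral_vpoisson hf hf0
  have hs : Summable fun k => secondMoment π f (viter κ (m + k) f) i j := by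
    refine Summable.of_norm_bounded
      (h.hasSum_geometric (c * (B * c) * (∫ z, V z ∂π) * r ^ m)).summable fun k => ?_
    refine (h.abs_secondMoment_viter_le hf hf hf0 (m + k) i j).trans (le_of_eq ?_)
    rw [pow_add]; ring
  rw [hs.hasSum_iff_tendsto_nat]
  have e : ∀ n, ∑ k ∈ Finset.range n, secondMoment π f (viter κ (m + k) f) i j =
      secondMoment π f (viter κ m (vpoisson κ f)) i j
        - secondMoment π f (viter κ (m + n) (vpoisson κ f)) i j := by
    intro n
    induction n with
    | zero => simp
    | succ n ih =>
      rw [Finset.sum_range_succ, ih]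
      have := congrFun (congrFun (h.secondMoment_viter_vpoisson hf hf hf0 (m + n)) i) j
      rw [Matrix.add_apply] at this
      rw [this, ← add_assoc]
      ring
  simp only [e]
  have ht : Tendsto (fun n => secondMoment π f (viter κ (m + n) (vpoisson κ f)) i j) atTop
      (𝓝 0) := by
    have hb : Tendsto (fun n : ℕ => c * (B * (B * c / (1 - r))) * (∫ z, V z ∂π) * r ^ m * r ^ n)
        atTop (𝓝 0) := by
      have := (tendsto_pow_atTop_nhds_zero_of_lt_one h.rate_pos.le h.rate_lt_one).const_mul
        (c * (B * (B * c / (1 - r))) * (∫ z, V z ∂π) * r ^ m)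
      simpa using this
    refine squeeze_zero_norm (fun n => ?_) hb
    refine (h.abs_secondMoment_viter_le hf hp hp0 (m + n) i j).trans (le_of_eq ?_)
    rw [pow_add]; ring
  simpa using ht.const_sub (secondMoment π f (viter κ m (vpoisson κ f)) i j)

theorem IsSqrtErgodic.hasSum_autocov (h : IsSqrtErgodic κ π V r B) {f : Z → Fin d → ℝ}
    (hf : ∀ i, IsSqrtBdd V c fun z => f z i) (hf0 : ∀ i, ∫ z, f z i ∂π = 0) (i j : Fin d) :
    HasSum (fun k : ℤ => autocov κ π f k i j)
      (secondMoment π f (vpoisson κ f) j i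
        + secondMoment π f (viter κ 1 (vpoisson κ f)) i j) := by
  refine HasSum.of_nat_of_neg_add_one ?_ ?_
  · simp only [h.autocov_natCast hf]
    have := h.hasSum_secondMoment hf hf0 0 j i
    rw [viter_zero fun i => (h.isSqrtBdd_vpoisson hf hf0 i).measurable] at this
    simpa using this
  · simp only [h.autocov_neg hf]
    simpa only [add_comm 1] using h.hasSum_secondMoment hf hf0 1 i j

theorem IsSqrtErgodic.noiseCov_eq (h : IsSqrtErgodic κ π V r B) {f : Z → Fin d → ℝ}
    (hf : ∀ i, IsSqrtBdd V c fun z => f z i) (hf0 : ∀ i, ∫ z, f z i ∂π = 0) :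
    noiseCov κ π f = secondMoment π (vpoisson κ f) f
      + secondMoment π f (viter κ 1 (vpoisson κ f)) := by
  ext i j
  rw [← secondMoment_transpose π f (vpoisson κ f)]
  exact (h.hasSum_autocov hf hf0 i j).tsum_eq

/-- The asymptotic covariance equals the covariance of the stationary martingale difference of f̂.
-/
theorem IsSqrtErgodic.noiseCov_posSemidef (h : IsSqrtErgodic κ π V r B) {f : Z → Fin d → ℝ}
    (hf : ∀ i, IsSqrtBdd V c fun z => f z i) (hf0 : ∀ i, ∫ z, f z i ∂π = 0) :
    (noiseCov κ π f).PosSemidef := by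
  have hp := h.isSqrtBdd_vpoisson hf hf0
  have hp0 := h.integral_vpoisson hf hf0
  obtain ⟨h1, -, h2⟩ := h.crossCov_mdiff (f := vpoisson κ f) (g := vpoisson κ f) hp hp0 hp hp0
  rw [h.viter_one_vpoisson hf hf0,
    secondMoment_sub_secondMoment h.one_le h.integrable_inv hp hp hf hf,
    ← h.viter_one_vpoisson hf hf0, ← h.noiseCov_eq hf hf0] at h1
  rw [← h1]
  exact secondMoment_posSemidef (π ⊗ₘ κ) (mdiff κ (vpoisson κ f)) h2

/-- The covariance between the martingale differences of the two Poisson solutions. -/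
theorem IsSqrtErgodic.crossCov_vpoisson (h : IsSqrtErgodic κ π V r B) {f : Z → Fin d → ℝ}
    (hf : ∀ i, IsSqrtBdd V c fun z => f z i) (hf0 : ∀ i, ∫ z, f z i ∂π = 0) :
    crossCov κ π (mdiff κ (vpoisson κ f)) (mdiff κ (vpoisson κ (vpoisson κ f)))
        = statCov π (vpoisson κ f)
          + secondMoment π f (viter κ 1 (vpoisson κ (vpoisson κ f))) ∧
      crossCov κ π (mdiff κ (vpoisson κ f)) (fun p => vpoisson κ (vpoisson κ f) p.2)
        = statCov π (vpoisson κ f)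
          + secondMoment π f (viter κ 1 (vpoisson κ (vpoisson κ f))) := by
  have hp := h.isSqrtBdd_vpoisson hf hf0
  have hp0 := h.integral_vpoisson hf hf0
  have hq := h.isSqrtBdd_vpoisson hp hp0
  have hq0 := h.integral_vpoisson hp hp0
  obtain ⟨h1, h2, -⟩ := h.crossCov_mdiff (f := vpoisson κ f) (g := vpoisson κ (vpoisson κ f))
    hp hp0 hq hq0
  -- Both covariances agree because a martingale difference is orthogonal to functions of the
  -- previous state.
  rw [h1, h2, h.viter_one_vpoisson hf hf0, h.viter_one_vpoisson hp hp0,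
    secondMoment_sub_secondMoment h.one_le h.integrable_inv hp hq hf hp]
  exact ⟨rfl, rfl⟩

end StationaryMoments

/-! ### Laws of the chain. -/

section Chain

variable {Z : Type*} [MeasurableSpace Z] {κ : Kernel Z Z}
  {Ω : Type*} {mΩ : MeasurableSpace Ω} {P : Measure Ω} [IsProbabilityMeasure P]
  {ℱ : Filtration ℕ mΩ} {z₀ : Z} {Φ : ℕ → Ω → Z}

theorem IsMarkovChain.measurable (h : IsMarkovChain P ℱ κ z₀ Φ) (n : ℕ) : Measurable (Φ n) :=
  (h.adapted n).mono (ℱ.le n) le_rfl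

variable [IsMarkovKernel κ]

theorem IsMarkovChain.measure_inter_preimage (h : IsMarkovChain P ℱ κ z₀ Φ) (n : ℕ)
    {s : Set Ω} (hs : MeasurableSet[ℱ n] s) {t : Set Z} (ht : MeasurableSet t) :
    P (s ∩ Φ (n + 1) ⁻¹' t) = ∫⁻ ω in s, κ (Φ n ω) t ∂P := by
  have hA : MeasurableSet (Φ (n + 1) ⁻¹' t) := h.measurable _ ht
  have hs' : MeasurableSet s := ℱ.le n s hs
  have h1 : ∫ ω in s, (κ (Φ n ω)).real t ∂P = P.real (s ∩ Φ (n + 1) ⁻¹' t) := by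
    rw [← setIntegral_congr_ae hs' ((h.markov n t ht).mono fun ω hω _ => hω),
      setIntegral_condExp (ℱ.le n) ((integrable_const (1 : ℝ)).indicator hA) hs,
      integral_indicator hA, Measure.restrict_restrict hA]
    simp [Set.inter_comm]
  have hm : Measurable fun ω => κ (Φ n ω) t :=
    (Kernel.measurable_coe κ ht).comp (h.measurable n)
  have hint : Integrable (fun ω => (κ (Φ n ω)).real t) (P.restrict s) := by
    refine (integrable_const (1 : ℝ)).mono' hm.ennreal_toReal.aestronglyMeasurable
      (Eventually.of_forall fun ω => ?_)
    rw [Real.norm_eq_abs, abs_of_nonneg measureReal_nonneg]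
    exact measureReal_le_one
  rw [← ENNReal.ofReal_toReal (measure_ne_top P (s ∩ Φ (n + 1) ⁻¹' t))]
  change ENNReal.ofReal (P.real _) = _
  rw [← h1, ofReal_integral_eq_lintegral_ofReal hint
    (Eventually.of_forall fun ω => measureReal_nonneg)]
  refine lintegral_congr fun ω => ?_
  rw [Measure.real, ENNReal.ofReal_toReal (measure_ne_top _ _)]

theorem IsMarkovChain.map_eq (h : IsMarkovChain P ℱ κ z₀ Φ) (n : ℕ) :
    P.map (Φ n) = (κ ^ n) z₀ := by
  induction n with
  | zero =>
    rw [Measure.map_congr h.initial, Measure.map_const, measure_univ, one_smul, pow_zero]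
    rfl
  | succ n ih =>
    ext t ht
    rw [Kernel.pow_succ_apply_eq_lintegral κ n z₀ ht, ← ih,
      lintegral_map (Kernel.measurable_coe κ ht) (h.measurable n),
      Measure.map_apply (h.measurable _) ht]
    have := h.measure_inter_preimage n MeasurableSet.univ ht
    rwa [Set.univ_inter, Measure.restrict_univ] at this

/-- The Markov property as an identity of joint laws. It suffices to check rectangles, where it is
the integrated form `measure_inter_preimage`. -/
theorem IsMarkovChain.map_prod_eq (h : IsMarkovChain P ℱ κ z₀ Φ) (n : ℕ) {E : Type*}
    [MeasurableSpace E] {Y : Ω → E} (hY : Measurable[ℱ n] Y) :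
    P.map (fun ω => ((Y ω, Φ n ω), Φ (n + 1) ω)) =
      P.map (fun ω => (Y ω, Φ n ω)) ⊗ₘ (κ.comap Prod.snd measurable_snd) := by
  have hY' : Measurable Y := hY.mono (ℱ.le n) le_rfl
  have hYΦ : Measurable fun ω => (Y ω, Φ n ω) := hY'.prodMk (h.measurable n)
  have : IsProbabilityMeasure (P.map fun ω => (Y ω, Φ n ω)) :=
    Measure.isProbabilityMeasure_map hYΦ.aemeasurable
  have : IsFiniteMeasure (P.map fun ω => ((Y ω, Φ n ω), Φ (n + 1) ω)) := inferInstance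
  refine Measure.ext_prod fun {s t} hs ht => ?_
  rw [Measure.map_apply (hYΦ.prodMk (h.measurable _)) (hs.prod ht),
    Measure.compProd_apply_prod hs ht]
  simp only [Kernel.comap_apply]
  rw [setLIntegral_map (f := fun x : E × Z => κ x.2 t) hs
    ((Kernel.measurable_coe κ ht).comp measurable_snd) hYΦ]
  have hs' : MeasurableSet[ℱ n] ((fun ω => (Y ω, Φ n ω)) ⁻¹' s) :=
    (hY.prodMk (h.adapted n)) hs
  exact h.measure_inter_preimage n hs' ht

theorem IsMarkovChain.integral_comp (h : IsMarkovChain P ℱ κ z₀ Φ) (n : ℕ) {g : Z → ℝ}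
    (hg : Measurable g) : ∫ ω, g (Φ n ω) ∂P = iter κ n g z₀ := by
  rw [iter, ← h.map_eq n, integral_map (h.measurable n).aemeasurable hg.aestronglyMeasurable]

theorem IsMarkovChain.integrable_comp (h : IsMarkovChain P ℱ κ z₀ Φ) (n : ℕ) {g : Z → ℝ}
    (hgi : Integrable g ((κ ^ n) z₀)) : Integrable (fun ω => g (Φ n ω)) P := by
  rw [← h.map_eq n] at hgi
  exact hgi.comp_measurable (h.measurable n)

/-- Fubini for the joint law of Y, Φ_n and Φ_{n+1}; integrability of the product alone suffices. -/
theorem IsMarkovChain.integral_mul_comp (h : IsMarkovChain P ℱ κ z₀ Φ) (n : ℕ) {Y : Ω → ℝ}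
    (hY : Measurable[ℱ n] Y) {g : Z → ℝ} (hg : Measurable g)
    (hi : Integrable (fun ω => Y ω * g (Φ (n + 1) ω)) P) :
    ∫ ω, Y ω * g (Φ (n + 1) ω) ∂P = ∫ ω, Y ω * iter κ 1 g (Φ n ω) ∂P := by
  have hY' : Measurable Y := hY.mono (ℱ.le n) le_rfl
  have hYΦ : Measurable fun ω => (Y ω, Φ n ω) := hY'.prodMk (h.measurable n)
  have hYΦΦ : Measurable fun ω => ((Y ω, Φ n ω), Φ (n + 1) ω) := hYΦ.prodMk (h.measurable _)
  have : IsProbabilityMeasure (P.map fun ω => (Y ω, Φ n ω)) :=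
    Measure.isProbabilityMeasure_map hYΦ.aemeasurable
  let G : (ℝ × Z) × Z → ℝ := fun p => p.1.1 * g p.2
  have hG : Measurable G := (measurable_fst.comp measurable_fst).mul (hg.comp measurable_snd)
  have hGi : Integrable G (P.map (fun ω => (Y ω, Φ n ω)) ⊗ₘ (κ.comap Prod.snd measurable_snd)) := by
    rw [← h.map_prod_eq n hY]
    exact (integrable_map_measure hG.aestronglyMeasurable hYΦΦ.aemeasurable).2 hi
  have e : ∫ ω, Y ω * g (Φ (n + 1) ω) ∂P =
      ∫ p, G p ∂(P.map (fun ω => ((Y ω, Φ n ω), Φ (n + 1) ω))) :=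
    (integral_map hYΦΦ.aemeasurable hG.aestronglyMeasurable).symm
  rw [e, h.map_prod_eq n hY, Measure.integral_compProd hGi]
  simp only [G, integral_const_mul, Kernel.comap_apply]
  rw [iter_one, integral_map (f := fun x : ℝ × Z => x.1 * ∫ y, g y ∂(κ x.2)) hYΦ.aemeasurable
    (measurable_fst.mul (hg.stronglyMeasurable.integral_kernel.measurable.comp
      measurable_snd)).aestronglyMeasurable]

end Chain

/-! ### Bilinearity of second moments. -/

section SecondMomentAlgebra

variable {Ω : Type*} {mΩ : MeasurableSpace Ω} {P : Measure Ω} {d : ℕ}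

theorem memLp_mulVec {X : Ω → Fin d → ℝ} (hX : ∀ i, MemLp (fun ω => X ω i) 2 P)
    (M : Matrix (Fin d) (Fin d) ℝ) (i : Fin d) : MemLp (fun ω => (M *ᵥ X ω) i) 2 P := by
  simp only [mulVec, dotProduct]
  exact memLp_finsetSum _ fun j _ => (hX j).const_mul _

theorem secondMoment_add_left {X X' Y : Ω → Fin d → ℝ} (hX : ∀ i, MemLp (fun ω => X ω i) 2 P)
    (hX' : ∀ i, MemLp (fun ω => X' ω i) 2 P) (hY : ∀ i, MemLp (fun ω => Y ω i) 2 P) :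
    secondMoment P (fun ω => X ω + X' ω) Y = secondMoment P X Y + secondMoment P X' Y := by
  ext i j
  simp only [secondMoment, of_apply, Matrix.add_apply, Pi.add_apply, add_mul]
  exact integral_add ((hX i).integrable_mul (hY j)) ((hX' i).integrable_mul (hY j))

theorem secondMoment_smul_left (c : ℝ) (X Y : Ω → Fin d → ℝ) :
    secondMoment P (fun ω => c • X ω) Y = c • secondMoment P X Y := by
  ext i j
  simp only [secondMoment, of_apply, Matrix.smul_apply, Pi.smul_apply, smul_eq_mul, mul_assoc]
  exact integral_const_mul _ _

theorem secondMoment_mulVec_left {X Y : Ω → Fin d → ℝ} (M : Matrix (Fin d) (Fin d) ℝ)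
    (hX : ∀ i, MemLp (fun ω => X ω i) 2 P) (hY : ∀ i, MemLp (fun ω => Y ω i) 2 P) :
    secondMoment P (fun ω => M *ᵥ X ω) Y = M * secondMoment P X Y := by
  ext i j
  have hi : ∀ k, Integrable (fun ω => M i k * (X ω k * Y ω j)) P := fun k =>
    ((hX k).integrable_mul (hY j)).const_mul (M i k)
  simp only [secondMoment, of_apply, Matrix.mul_apply, ← integral_const_mul]
  rw [← integral_finsetSum _ fun k _ => hi k]
  refine integral_congr_ae (Eventually.of_forall fun ω => ?_)
  simp only [mulVec, dotProduct, Finset.sum_mul, mul_assoc]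

theorem secondMoment_add_right {X Y Y' : Ω → Fin d → ℝ} (hX : ∀ i, MemLp (fun ω => X ω i) 2 P)
    (hY : ∀ i, MemLp (fun ω => Y ω i) 2 P) (hY' : ∀ i, MemLp (fun ω => Y' ω i) 2 P) :
    secondMoment P X (fun ω => Y ω + Y' ω) = secondMoment P X Y + secondMoment P X Y' := by
  rw [← secondMoment_transpose, secondMoment_add_left hY hY' hX, transpose_add,
    secondMoment_transpose, secondMoment_transpose]

theorem secondMoment_smul_right (c : ℝ) (X Y : Ω → Fin d → ℝ) :
    secondMoment P X (fun ω => c • Y ω) = c • secondMoment P X Y := by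
  rw [← secondMoment_transpose, secondMoment_smul_left, transpose_smul, secondMoment_transpose]

theorem secondMoment_mulVec_right {X Y : Ω → Fin d → ℝ} (M : Matrix (Fin d) (Fin d) ℝ)
    (hX : ∀ i, MemLp (fun ω => X ω i) 2 P) (hY : ∀ i, MemLp (fun ω => Y ω i) 2 P) :
    secondMoment P X (fun ω => M *ᵥ Y ω) = secondMoment P X Y * Mᵀ := by
  rw [← secondMoment_transpose, secondMoment_mulVec_left M hY hX, transpose_mul,
    secondMoment_transpose]

end SecondMomentAlgebra

/-! ### Moment recursions and expansions for the stochastic approximation path. -/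

section Covariance

attribute [local instance] Matrix.linftyOpNormedRing Matrix.linftyOpNormedAlgebra

variable {Z : Type*} [MeasurableSpace Z] {κ : Kernel Z Z} {π : Measure Z} {V : Z → ℝ}
  {r B c : ℝ} {d : ℕ} {Ω : Type*} {mΩ : MeasurableSpace Ω} {P : Measure Ω}
  [IsProbabilityMeasure P] {ℱ : Filtration ℕ mΩ} {z₀ : Z} {Φ : ℕ → Ω → Z}
  {A : Matrix (Fin d) (Fin d) ℝ} {x₀ : Fin d → ℝ} {f : Z → Fin d → ℝ}

/-- The recursion driven by the noise `f (Φ n)`. -/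
def saPath (A : Matrix (Fin d) (Fin d) ℝ) (x₀ : Fin d → ℝ) (f : Z → Fin d → ℝ)
    (Φ : ℕ → Ω → Z) (n : ℕ) (ω : Ω) : Fin d → ℝ :=
  linearSA A x₀ (fun k => f (Φ k ω)) n

omit [MeasurableSpace Z] mΩ in
theorem saPath_succ (n : ℕ) (ω : Ω) : saPath A x₀ f Φ (n + 1) ω =
    (1 + (1 / ((n : ℝ) + 1)) • A) *ᵥ saPath A x₀ f Φ n ω
      + (1 / ((n : ℝ) + 1)) • f (Φ (n + 1) ω) := by
  change saPath A x₀ f Φ n ω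
    + (1 / ((n : ℝ) + 1)) • (A *ᵥ saPath A x₀ f Φ n ω + f (Φ (n + 1) ω)) = _
  rw [add_mulVec, one_mulVec, smul_mulVec, smul_add, add_assoc]

theorem IsMarkovChain.measurable_saPath (hΦ : IsMarkovChain P ℱ κ z₀ Φ)
    (hf : ∀ i, Measurable fun z => f z i) (n : ℕ) (i : Fin d) :
    Measurable[ℱ n] fun ω => saPath A x₀ f Φ n ω i := by
  induction n generalizing i with
  | zero => exact measurable_const
  | succ n ih =>
    simp only [saPath_succ, Pi.add_apply, Pi.smul_apply, smul_eq_mul, mulVec, dotProduct]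
    have h1 : ∀ i, Measurable[ℱ (n + 1)] fun ω => saPath A x₀ f Φ n ω i := fun i =>
      (ih i).mono (ℱ.mono n.le_succ) le_rfl
    have h2 : Measurable[ℱ (n + 1)] fun ω => f (Φ (n + 1) ω) i := (hf i).comp (hΦ.adapted (n + 1))
    exact (Finset.measurable_fun_sum _ fun j _ => (h1 j).const_mul _).add (h2.const_mul _)

theorem IsSqrtErgodic.viter_one_viter (h : IsSqrtErgodic κ π V r B)
    (hf : ∀ i, IsSqrtBdd V c fun z => f z i) (k : ℕ) :
    viter κ 1 (viter κ k f) = viter κ (k + 1) f := by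
  funext z i
  exact (iter_add ((hf i).integrable h.one_le (h.integrable_pow _ z))).symm

variable [IsMarkovKernel κ]

theorem IsSqrtErgodic.memLp_comp (h : IsSqrtErgodic κ π V r B) (hΦ : IsMarkovChain P ℱ κ z₀ Φ)
    {g : Z → ℝ} (hg : IsSqrtBdd V c g) (n : ℕ) : MemLp (fun ω => g (Φ n ω)) 2 P := by
  refine (memLp_two_iff_integrable_sq
    (hg.measurable.comp (hΦ.measurable n)).aestronglyMeasurable).2 ?_
  have := hΦ.integrable_comp n (hg.integrable_mul hg h.one_le (h.integrable_pow n z₀))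
  simpa only [pow_two, Function.comp_apply] using this

theorem IsSqrtErgodic.memLp_saPath (h : IsSqrtErgodic κ π V r B)
    (hΦ : IsMarkovChain P ℱ κ z₀ Φ) (hf : ∀ i, IsSqrtBdd V c fun z => f z i) (n : ℕ)
    (i : Fin d) : MemLp (fun ω => saPath A x₀ f Φ n ω i) 2 P := by
  induction n generalizing i with
  | zero => exact memLp_const (x₀ i)
  | succ n ih =>
    simp only [saPath_succ, Pi.add_apply, Pi.smul_apply, smul_eq_mul]
    exact (memLp_mulVec ih _ i).add ((h.memLp_comp hΦ (hf i) (n + 1)).const_mul _)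

theorem IsSqrtErgodic.secondMoment_saPath_comp (h : IsSqrtErgodic κ π V r B)
    (hΦ : IsMarkovChain P ℱ κ z₀ Φ) (hf : ∀ i, IsSqrtBdd V c fun z => f z i)
    {c' : ℝ} {g : Z → Fin d → ℝ} (hg : ∀ i, IsSqrtBdd V c' fun z => g z i) (n : ℕ) :
    secondMoment P (saPath A x₀ f Φ n) (fun ω => g (Φ (n + 1) ω)) =
      secondMoment P (saPath A x₀ f Φ n) (fun ω => viter κ 1 g (Φ n ω)) := by
  ext i j
  exact hΦ.integral_mul_comp n (hΦ.measurable_saPath (fun i => (hf i).measurable) n i)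
    (hg j).measurable ((h.memLp_saPath hΦ hf n i).integrable_mul
      (h.memLp_comp hΦ (hg j) (n + 1)))

/-- The recursion for the lagged cross-moments `E[θ_n (Pᵏ f)(Φ_n)ᵀ]`. -/
theorem IsSqrtErgodic.secondMoment_saPath_succ (h : IsSqrtErgodic κ π V r B)
    (hΦ : IsMarkovChain P ℱ κ z₀ Φ) (hf : ∀ i, IsSqrtBdd V c fun z => f z i)
    (hf0 : ∀ i, ∫ z, f z i ∂π = 0) (n k : ℕ) :
    secondMoment P (saPath A x₀ f Φ (n + 1)) (fun ω => viter κ k f (Φ (n + 1) ω)) =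
      (1 + (1 / ((n : ℝ) + 1)) • A)
          * secondMoment P (saPath A x₀ f Φ n) (fun ω => viter κ (k + 1) f (Φ n ω))
        + (1 / ((n : ℝ) + 1)) •
          secondMoment P (fun ω => f (Φ (n + 1) ω)) (fun ω => viter κ k f (Φ (n + 1) ω)) := by
  have hk := h.isSqrtBdd_viter hf hf0 k
  have hθ := h.memLp_saPath (A := A) (x₀ := x₀) hΦ hf n
  have hF := fun i => h.memLp_comp hΦ (hf i) (n + 1)
  have hK := fun i => h.memLp_comp hΦ (hk i) (n + 1)
  have haF : ∀ i, MemLp (fun ω => ((1 / ((n : ℝ) + 1)) • f (Φ (n + 1) ω)) i) 2 P := fun i =>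
    (hF i).const_mul _
  rw [funext (saPath_succ n), secondMoment_add_left (memLp_mulVec hθ _) haF hK,
    secondMoment_mulVec_left _ hθ hK, secondMoment_smul_left,
    h.secondMoment_saPath_comp hΦ hf hk n, h.viter_one_viter hf]

/-- The recursion for the covariance `E[θ_n θ_nᵀ]`. -/
theorem IsSqrtErgodic.covariance_succ (h : IsSqrtErgodic κ π V r B)
    (hΦ : IsMarkovChain P ℱ κ z₀ Φ) (hf : ∀ i, IsSqrtBdd V c fun z => f z i) (n : ℕ) :
    secondMoment P (saPath A x₀ f Φ (n + 1)) (saPath A x₀ f Φ (n + 1)) =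
      (1 + (1 / ((n : ℝ) + 1)) • A) * secondMoment P (saPath A x₀ f Φ n) (saPath A x₀ f Φ n)
          * (1 + (1 / ((n : ℝ) + 1)) • Aᵀ)
        + (1 / ((n : ℝ) + 1)) • ((1 + (1 / ((n : ℝ) + 1)) • A)
          * secondMoment P (saPath A x₀ f Φ n) (fun ω => viter κ 1 f (Φ n ω)))
        + (1 / ((n : ℝ) + 1)) • ((secondMoment P (saPath A x₀ f Φ n)
            (fun ω => viter κ 1 f (Φ n ω)))ᵀ * (1 + (1 / ((n : ℝ) + 1)) • Aᵀ))
        + (1 / ((n : ℝ) + 1)) ^ 2 •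
          secondMoment P (fun ω => f (Φ (n + 1) ω)) (fun ω => f (Φ (n + 1) ω)) := by
  have hθ := h.memLp_saPath (A := A) (x₀ := x₀) hΦ hf n
  have hF := fun i => h.memLp_comp hΦ (hf i) (n + 1)
  set a : ℝ := 1 / ((n : ℝ) + 1) with ha
  have hGθ := memLp_mulVec hθ (1 + a • A)
  have haF : ∀ i, MemLp (fun ω => (a • f (Φ (n + 1) ω)) i) 2 P := fun i => (hF i).const_mul a
  have hsum : ∀ i, MemLp (fun ω => ((1 + a • A) *ᵥ saPath A x₀ f Φ n ω
      + a • f (Φ (n + 1) ω) : Fin d → ℝ) i) 2 P := fun i => (hGθ i).add (haF i)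
  have e : (1 + a • A)ᵀ = 1 + a • Aᵀ := by simp
  have hcross := h.secondMoment_saPath_comp (A := A) (x₀ := x₀) hΦ hf hf n
  rw [funext (saPath_succ n), ← ha, secondMoment_add_left hGθ haF hsum,
    secondMoment_add_right hGθ hGθ haF, secondMoment_add_right haF hGθ haF,
    secondMoment_mulVec_left _ hθ hGθ, secondMoment_mulVec_right _ hθ hθ,
    secondMoment_mulVec_left _ hθ haF, secondMoment_smul_right, hcross,
    secondMoment_smul_left, secondMoment_mulVec_right _ hF hθ,
    ← secondMoment_transpose P (saPath A x₀ f Φ n) (fun ω => f (Φ (n + 1) ω)), hcross,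
    secondMoment_smul_left, secondMoment_smul_right, e, mul_smul_comm, smul_smul, ← pow_two,
    mul_assoc]
  abel

/-- A product of two functions of size √V is of size V, so V-ergodicity itself applies to it. -/
theorem IsSqrtErgodic.abs_secondMoment_comp_sub_le (h : IsSqrtErgodic κ π V r B)
    (hΦ : IsMarkovChain P ℱ κ z₀ Φ) {c' : ℝ} {u g : Z → Fin d → ℝ}
    (hu : ∀ i, IsSqrtBdd V c fun z => u z i) (hg : ∀ i, IsSqrtBdd V c' fun z => g z i) (n : ℕ)
    (i j : Fin d) :
    |(secondMoment P (fun ω => u (Φ n ω)) (fun ω => g (Φ n ω)) - secondMoment π u g) i j|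
      ≤ B * (c * c') * r ^ n * V z₀ := by
  have e : secondMoment P (fun ω => u (Φ n ω)) (fun ω => g (Φ n ω)) i j
      = iter κ n (fun z => u z i * g z j) z₀ :=
    hΦ.integral_comp n (g := fun z => u z i * g z j) ((hu i).measurable.mul (hg j).measurable)
  rw [Matrix.sub_apply, e]
  exact h.ergodic (c * c') _ (mul_nonneg (hu i).nonneg (hg i).nonneg)
    ((hu i).measurable.mul (hg j).measurable) ((hu i).abs_mul_le (hg j) h.one_le) n z₀

/-- Second-order expansion of the lagged cross-moments. -/
theorem IsSqrtErgodic.crossMoment_expansion [IsProbabilityMeasure π]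
    (h : IsSqrtErgodic κ π V r B) (hΦ : IsMarkovChain P ℱ κ z₀ Φ)
    (hf : ∀ i, IsSqrtBdd V c fun z => f z i) (hf0 : ∀ i, ∫ z, f z i ∂π = 0) :
    ∃ L : ℝ, ∀ n : ℕ, 1 ≤ n →
      ‖secondMoment P (saPath A x₀ f Φ n) (fun ω => viter κ 1 f (Φ n ω))
        - (1 / (n : ℝ)) • secondMoment π f (viter κ 1 (vpoisson κ f))
        - (1 / (n : ℝ)) ^ 2 •
          ((1 + A) * secondMoment π f (viter κ 2 (vpoisson κ (vpoisson κ f))))‖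
        ≤ L * (1 / (n : ℝ)) ^ 3 := by
  have hp := h.isSqrtBdd_vpoisson hf hf0
  have hp0 := h.integral_vpoisson hf hf0
  have hq := h.isSqrtBdd_vpoisson hp hp0
  have hq0 := h.integral_vpoisson hp hp0
  have hr0 := h.rate_pos
  have hr1 := h.rate_lt_one
  have hB := h.const_nonneg
  have hv0 : 0 ≤ V z₀ := by linarith [h.one_le z₀]
  -- The sign of c is only known through some coordinate of f.
  rcases isEmpty_or_nonempty (Fin d) with hd | ⟨⟨i₀⟩⟩
  · refine ⟨0, fun n hn => le_of_eq ?_⟩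
    rw [zero_mul, norm_eq_zero]
    exact Subsingleton.elim _ _
  have hc := (hf i₀).nonneg
  set c₁ := c * (B * (B * c / (1 - r))) * (∫ z, V z ∂π) with hc₁
  set c₂ := c * (B * (B * (B * c / (1 - r)) / (1 - r))) * (∫ z, V z ∂π) with hc₂
  set c₃ := ‖x₀‖ * (B * c * √(V z₀)) with hc₃
  set c₄ := B * (c * (B * c)) * V z₀ with hc₄
  set D : ℝ := (d : ℝ) ^ 2 with hD
  have hD0 : 0 ≤ D := by positivity
  set A1 : ℝ := ‖(1 + A : Matrix (Fin d) (Fin d) ℝ)‖ with hA1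
  have hV0 : 0 ≤ ∫ z, V z ∂π := integral_nonneg fun z => by
    have := h.one_le z
    simp only [Pi.zero_apply]; linarith
  have h1r : 0 < 1 - r := by linarith
  have hc₁0 : 0 ≤ c₁ := by positivity
  have hc₂0 : 0 ≤ c₂ := by positivity
  have hc₃0 : 0 ≤ c₃ := by positivity
  have hc₄0 : 0 ≤ c₄ := by positivity
  set b : ℝ := D * c₁ + A1 * (D * c₂) + D * c₃ + D * c₄ with hb
  have t1 : 0 ≤ D * c₁ := by positivity
  have t2 : 0 ≤ A1 * (D * c₂) := by positivity
  have t3 : 0 ≤ D * c₃ := by positivity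
  have t4 : 0 ≤ D * c₄ := by positivity
  have hpk : ∀ k : ℕ, r ^ (k + 1) ≤ r ^ k := fun k =>
    pow_le_pow_of_le_one hr0.le hr1.le (Nat.le_succ k)
  obtain ⟨L, hL⟩ := lag_expansion (A := A) (r := r) (c := b)
    (m := fun n k => secondMoment P (saPath A x₀ f Φ n) (fun ω => viter κ k f (Φ n ω)))
    (S := fun k => secondMoment π f (viter κ k f))
    (e := fun n k => secondMoment P (fun ω => f (Φ (n + 1) ω))
      (fun ω => viter κ k f (Φ (n + 1) ω)) - secondMoment π f (viter κ k f))
    (μ₁ := fun k => secondMoment π f (viter κ k (vpoisson κ f)))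
    (μ₂ := fun k => (1 + A) * secondMoment π f (viter κ (k + 1) (vpoisson κ (vpoisson κ f))))
    hr0 hr1
    (fun n k => by
      simp only [add_sub_cancel]
      exact h.secondMoment_saPath_succ hΦ hf hf0 n k)
    (fun k => h.secondMoment_viter_vpoisson hf hf hf0 k)
    (fun k => by
      rw [← mul_add]
      exact congrArg _ (h.secondMoment_viter_vpoisson hf hp hp0 (k + 1)))
    (fun k => by
      have hk : ∀ i j, |secondMoment P (saPath A x₀ f Φ 0) (fun ω => viter κ k f (Φ 0 ω)) i j|
          ≤ c₃ * r ^ k := by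
        intro i j
        have hm := (h.isSqrtBdd_viter hf hf0 k j).measurable
        have e : secondMoment P (saPath A x₀ f Φ 0) (fun ω => viter κ k f (Φ 0 ω)) i j
            = x₀ i * viter κ k f z₀ j := by
          have := hΦ.integral_comp 0 (g := fun z => viter κ k f z j) hm
          rw [iter_zero hm] at this
          change _ = viter κ k f z₀ j at this
          rw [← this]
          exact integral_const_mul _ _
        rw [e, abs_mul]
        calc |x₀ i| * |viter κ k f z₀ j| ≤ ‖x₀‖ * (B * c * r ^ k * √(V z₀)) :=
              mul_le_mul (norm_le_pi_norm x₀ i) ((h.isSqrtBdd_viter hf hf0 k j).abs_le z₀)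
                (abs_nonneg _) (norm_nonneg _)
          _ = c₃ * r ^ k := by rw [hc₃]; ring
      refine (norm_le_of_abs_apply_le hk).trans ?_
      rw [← mul_assoc]
      exact mul_le_mul_of_nonneg_right (by linarith) (by positivity))
    (fun k => by
      refine (norm_le_of_abs_apply_le (h.abs_secondMoment_viter_le hf hp hp0 k)).trans ?_
      rw [← mul_assoc]
      exact mul_le_mul_of_nonneg_right (by linarith) (by positivity))
    (fun k => by
      refine (norm_mul_le _ _).trans ?_
      refine (mul_le_mul_of_nonneg_left (norm_le_of_abs_apply_le
        (h.abs_secondMoment_viter_le hf hq hq0 (k + 1))) (norm_nonneg _)).trans ?_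
      calc A1 * (D * (c₂ * r ^ (k + 1))) ≤ A1 * (D * (c₂ * r ^ k)) := by
            exact mul_le_mul_of_nonneg_left (mul_le_mul_of_nonneg_left
              (mul_le_mul_of_nonneg_left (hpk k) hc₂0) hD0) (norm_nonneg _)
        _ = A1 * (D * c₂) * r ^ k := by ring
        _ ≤ b * r ^ k := mul_le_mul_of_nonneg_right (by linarith) (by positivity))
    (fun n k => by
      refine (norm_le_of_abs_apply_le (h.abs_secondMoment_comp_sub_le hΦ hf
        (h.isSqrtBdd_viter hf hf0 k) (n + 1))).trans ?_
      calc D * (B * (c * (B * c * r ^ k)) * r ^ (n + 1) * V z₀)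
          = D * c₄ * r ^ k * r ^ (n + 1) := by rw [hc₄]; ring
        _ ≤ b * r ^ k * r ^ n := by
            refine mul_le_mul (mul_le_mul_of_nonneg_right (by linarith) (by positivity)) (hpk n)
              (by positivity) (by positivity))
  -- Only lag 1 enters the covariance recursion.
  refine ⟨L * r ^ 1, fun n hn => ?_⟩
  refine (hL n hn 1).trans (le_of_eq (by ring))

/-- Second-order expansion of the covariance `E[θ_n θ_nᵀ]`. -/
theorem IsSqrtErgodic.covariance_saPath_expansion [IsProbabilityMeasure π]
    (h : IsSqrtErgodic κ π V r B) (hΦ : IsMarkovChain P ℱ κ z₀ Φ)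
    (hf : ∀ i, IsSqrtBdd V c fun z => f z i) (hf0 : ∀ i, ∫ z, f z i ∂π = 0)
    {p s K : ℝ} {ν : Matrix (Fin d) (Fin d) ℝ → ℝ}
    (hν : IsAdaptedNorm A Aᵀ p s K ν) (hK : 0 ≤ K) (hs : 0 < s) (hp1 : 1 ≤ p) (hp2 : p ≤ 5 / 4)
    {Sθ Ss : Matrix (Fin d) (Fin d) ℝ} (hSθ : IsLyapunov A (noiseCov κ π f) Sθ)
    (hSs : IsLyapunovTwo A (noiseCov κ π f) Sθ
      (crossCov κ π (mdiff κ (vpoisson κ (vpoisson κ f))) (mdiff κ (vpoisson κ f)))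
      (crossCov κ π (mdiff κ (vpoisson κ f)) (mdiff κ (vpoisson κ (vpoisson κ f)))) Ss) :
    ∃ M : ℝ, ∀ n : ℕ, 1 ≤ n →
      ‖secondMoment P (saPath A x₀ f Φ n) (saPath A x₀ f Φ n) - (1 / (n : ℝ)) • Sθ
        - (1 / (n : ℝ)) ^ 2 • (Ss + statCov π (vpoisson κ f)
          - crossCov κ π (mdiff κ (vpoisson κ f)) (fun p => vpoisson κ (vpoisson κ f) p.2)
          - crossCov κ π (fun p => vpoisson κ (vpoisson κ f) p.2) (mdiff κ (vpoisson κ f)))‖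
        ≤ M * (n : ℝ) ^ (-(2 * p)) := by
  have hp := h.isSqrtBdd_vpoisson hf hf0
  have hp0 := h.integral_vpoisson hf hf0
  have hr0 := h.rate_pos
  have hr1 := h.rate_lt_one
  obtain ⟨L, hL⟩ := h.crossMoment_expansion (A := A) (x₀ := x₀) hΦ hf hf0
  obtain ⟨c₂, hc₂0, hc₂⟩ := exists_pow_le_sq hr0.le hr1
  have hv0 : 0 ≤ V z₀ := by linarith [h.one_le z₀]
  set D : ℝ := (d : ℝ) ^ 2 with hD
  have hD0 : 0 ≤ D := by positivity
  have hB := h.const_nonneg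
  have hL0 : 0 ≤ L := by simpa using (norm_nonneg _).trans (hL 1 le_rfl)
  set L' : ℝ := D * (B * (c * c) * V z₀) * c₂ with hL'
  have hDB : 0 ≤ D * (B * (c * c) * V z₀) :=
    mul_nonneg hD0 (mul_nonneg (mul_nonneg hB (mul_self_nonneg c)) hv0)
  have hL'0 : 0 ≤ L' := mul_nonneg hDB hc₂0
  set L'' : ℝ := L + D * L + L' with hL''
  have hDL : 0 ≤ D * L := by positivity
  set U : Matrix (Fin d) (Fin d) ℝ := secondMoment π f (viter κ 1 (vpoisson κ (vpoisson κ f)))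
    with hU
  set U₂ : Matrix (Fin d) (Fin d) ℝ := secondMoment π f (viter κ 2 (vpoisson κ (vpoisson κ f)))
    with hU₂
  set μ : Matrix (Fin d) (Fin d) ℝ := secondMoment π f (viter κ 1 (vpoisson κ f)) with hμ
  -- This merges the contributions (1 + A) μ and (1 + A) U₂ of the cross moments into (1 + A) U, the
  -- quantity that the martingale covariances contain.
  have hUμ : U = U₂ + μ := h.secondMoment_viter_vpoisson hf hp hp0 1
  have hμS : secondMoment π (vpoisson κ f) f = μᵀ + secondMoment π f f := by
    have h1 := h.secondMoment_viter_vpoisson hf hf hf0 0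
    rw [viter_zero fun i => (hp i).measurable, viter_zero fun i => (hf i).measurable] at h1
    rw [← secondMoment_transpose, h1, transpose_add, secondMoment_transpose π f f]
  have hQ : noiseCov κ π f = μ + μᵀ + secondMoment π f f := by
    rw [h.noiseCov_eq hf hf0, hμS]; abel
  obtain ⟨hD1, hD2⟩ := h.crossCov_vpoisson hf hf0
  rw [← hU] at hD1 hD2
  have hC1 : crossCov κ π (mdiff κ (vpoisson κ (vpoisson κ f))) (mdiff κ (vpoisson κ f))
      = (statCov π (vpoisson κ f) + U)ᵀ := by
    rw [← hD1]; exact (secondMoment_transpose _ _ _).symm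
  have hC2 : crossCov κ π (fun p => vpoisson κ (vpoisson κ f) p.2) (mdiff κ (vpoisson κ f))
      = (statCov π (vpoisson κ f) + U)ᵀ := by
    rw [← hD2]; exact (secondMoment_transpose _ _ _).symm
  have hsym : (statCov π (vpoisson κ f))ᵀ = statCov π (vpoisson κ f) :=
    secondMoment_transpose _ _ _
  rw [isLyapunov_iff, one_smul] at hSθ
  rw [isLyapunovTwo_iff, hC1, hD1] at hSs
  rw [hC2, hD2]
  refine hν.covariance_expansion hK hs hp1 hp2 (L := L'')
    (m := fun n => secondMoment P (saPath A x₀ f Φ n) (fun ω => viter κ 1 f (Φ n ω)))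
    (m' := fun n => (secondMoment P (saPath A x₀ f Φ n) (fun ω => viter κ 1 f (Φ n ω)))ᵀ)
    (e := fun n => secondMoment P (fun ω => f (Φ (n + 1) ω)) (fun ω => f (Φ (n + 1) ω))
      - secondMoment π f f) (S₀ := secondMoment π f f)
    (μ₁ := μ) (μ₂ := (1 + A) * U₂) (μ₁' := μᵀ) (μ₂' := ((1 + A) * U₂)ᵀ) ?_ ?_ ?_ ?_ ?_ ?_
  · intro n
    simp only [add_sub_cancel]
    exact h.covariance_succ hΦ hf n
  · intro n hn
    exact (hL n hn).trans (mul_le_mul_of_nonneg_right (by linarith) (by positivity))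
  · intro n hn
    have := norm_transpose_le (secondMoment P (saPath A x₀ f Φ n)
      (fun ω => viter κ 1 f (Φ n ω)) - (1 / (n : ℝ)) • μ - (1 / (n : ℝ)) ^ 2 • ((1 + A) * U₂))
    rw [transpose_sub, transpose_sub, transpose_smul, transpose_smul] at this
    refine this.trans ((mul_le_mul_of_nonneg_left (hL n hn) hD0).trans ?_)
    rw [← mul_assoc]
    exact mul_le_mul_of_nonneg_right (by linarith) (by positivity)
  · intro n hn
    refine (norm_le_of_abs_apply_le
      (h.abs_secondMoment_comp_sub_le hΦ hf hf (n + 1))).trans ?_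
    calc D * (B * (c * c) * r ^ (n + 1) * V z₀) = D * (B * (c * c) * V z₀) * r ^ (n + 1) := by ring
      _ ≤ D * (B * (c * c) * V z₀) * (c₂ * (1 / ((n : ℝ) + 1)) ^ 2) :=
          mul_le_mul_of_nonneg_left ((pow_le_pow_of_le_one hr0.le hr1.le n.le_succ).trans (hc₂ n))
            hDB
      _ = L' * (1 / ((n : ℝ) + 1)) ^ 2 := by rw [hL']; ring
      _ ≤ _ := mul_le_mul_of_nonneg_right (by linarith) (by positivity)
  · rw [hSθ, hQ]; abel
  · rw [hQ] at hSs hSθ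
    rw [hUμ] at hSs ⊢
    simp only [transpose_add, transpose_mul, transpose_one, hsym, mul_add, add_mul, mul_sub,
      sub_mul, one_mul, mul_one, smul_add, smul_sub] at hSs ⊢
    -- After the substitutions Σ₂ = Σ_♯ - Σ_Z - U - Uᵀ, and the x³ condition is the sum of the two
    -- Lyapunov equations.
    linear_combination (norm := module) hSs + hSθ

end Covariance

end LinearSA

end

/-! ### The main theorem. -/

theorem theorem2p5 {d : ℕ} (A : Matrix (Fin d) (Fin d) ℝ)
    (hA : ∀ μ : ℂ, Module.End.HasEigenvalue
      (Matrix.toLin' (A.map (algebraMap ℝ ℂ))) μ → μ.re < -1)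
    (Q : Matrix (Fin d) (Fin d) ℝ) :
    -- `δ` depends only on `A` and on `Q = Σ_Δ`
    ∃ δ : ℝ, 0 < δ ∧
      ∀ (Z : Type*) [TopologicalSpace Z] [PolishSpace Z] [MeasurableSpace Z] [BorelSpace Z]
        (κ : Kernel Z Z) [IsMarkovKernel κ] (π : Measure Z) [IsProbabilityMeasure π]
        (V : Z → ℝ) (f : Z → Fin d → ℝ),
        Measurable V → (∀ z, 1 ≤ V z) →
        IsVUniformlyErgodic κ π V →
        (∀ i, Measurable fun z => f z i) →
        (∀ i, MemLV V fun z => f z i ^ 2) →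
        (∀ i, ∫ z, f z i ∂π = 0) →
        noiseCov κ π f = Q →
        -- the series that defines `Σ_Δ` converges
        (∀ i j, Summable fun k : ℤ => autocov κ π f k i j) ∧
        -- `fh`, `fhh`: the zero-mean solutions of the two Poisson equations
        ∃ fh fhh : Z → Fin d → ℝ,
          IsPoissonSolution κ π V f fh ∧
          (∀ h, IsPoissonSolution κ π V f h → h = fh) ∧
          (∀ i, MemLV V fun z => fh z i ^ 2) ∧
          IsPoissonSolution κ π V fh fhh ∧
          (∀ h, IsPoissonSolution κ π V fh h → h = fhh) ∧
          (∀ i, MemLV V fun z => fhh z i ^ 2) ∧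
        -- `Sθ = Σ_θ`, `Ss = Σ_♯`: the solutions of the two Lyapunov equations
        ∃ Sθ Ss : Matrix (Fin d) (Fin d) ℝ,
          Sθ.PosSemidef ∧ IsLyapunov A Q Sθ ∧ (∀ S, IsLyapunov A Q S → S = Sθ) ∧
          IsLyapunovTwo A Q Sθ (crossCov κ π (mdiff κ fhh) (mdiff κ fh))
            (crossCov κ π (mdiff κ fh) (mdiff κ fhh)) Ss ∧
          (∀ S, IsLyapunovTwo A Q Sθ (crossCov κ π (mdiff κ fhh) (mdiff κ fh))
            (crossCov κ π (mdiff κ fh) (mdiff κ fhh)) S → S = Ss) ∧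
        -- the expansion, for every chain with kernel `κ` and every initial condition
        ∀ (Ω : Type*) [mΩ : MeasurableSpace Ω] (P : Measure Ω) [IsProbabilityMeasure P]
          (ℱ : Filtration ℕ mΩ) (Φ : ℕ → Ω → Z)
          (z₀ : Z) (x₀ : Fin d → ℝ), IsMarkovChain P ℱ κ z₀ Φ →
          (∀ n i j, Integrable (fun ω =>
            linearSA A x₀ (fun k => f (Φ k ω)) n i *
              linearSA A x₀ (fun k => f (Φ k ω)) n j) P) ∧
          ∃ K : ℝ, ∀ n : ℕ, 1 ≤ n → ∀ i j,
            |(∫ ω, linearSA A x₀ (fun k => f (Φ k ω)) n i *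
                linearSA A x₀ (fun k => f (Φ k ω)) n j ∂P)
              - (n : ℝ)⁻¹ * Sθ i j
              - ((n : ℝ) ^ 2)⁻¹ *
                (Ss + statCov π fh
                  - crossCov κ π (mdiff κ fh) (fun p => fhh p.2)
                  - crossCov κ π (fun p => fhh p.2) (mdiff κ fh)) i j|
              ≤ K * (n : ℝ) ^ (-2 - δ) := by
  obtain ⟨p, s, K, ν, hp1, hp2, hs, hK, hν⟩ := exists_isAdaptedNorm_of_hasEigenvalue A hA
  -- The error n^(-2p) is n^(-2-δ) for this δ, and p was chosen from A alone.
  refine ⟨2 * p - 2, by linarith, ?_⟩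
  intro Z _ _ _ _ κ _ π _ V f hVm hV hE hfm hf2 hf0 hQ
  obtain ⟨r, B, hr0, hr1, hB, hsq, herg⟩ := hE.exists_sqrt hVm hV
  have h : IsSqrtErgodic κ π V r B :=
    ⟨hV, hE.invariant, hE.integrable_pow, hE.integrable_inv, hr0, hr1, hB, hsq, herg⟩
  obtain ⟨c, hf⟩ : ∃ c, ∀ i, IsSqrtBdd V c fun z => f z i := by
    choose c hc using fun i => exists_isSqrtBdd_of_memLV_sq hV (hfm i) (hf2 i)
    exact ⟨∑ i, c i, fun i => (hc i).mono
      (Finset.single_le_sum (fun j _ => (hc j).nonneg) (Finset.mem_univ i))⟩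
  have hp := h.isSqrtBdd_vpoisson hf hf0
  have hp0 := h.integral_vpoisson hf hf0
  have hq := h.isSqrtBdd_vpoisson hp hp0
  have hfh := h.isPoissonSolution_vpoisson hf hf0
  have hfhh := h.isPoissonSolution_vpoisson hp hp0
  refine ⟨fun i j => (h.hasSum_autocov hf hf0 i j).summable, vpoisson κ f,
    vpoisson κ (vpoisson κ f), hfh, fun g hg => h.poisson_unique hg hfh,
    fun i => (hp i).memLV_sq hV, hfhh, fun g hg => h.poisson_unique hg hfhh,
    fun i => (hq i).memLV_sq hV, ?_⟩
  obtain ⟨Sθ, hSθ, hSθu⟩ := hν.existsUnique_lyapunov hs (c := 1) (by linarith) (-Q)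
  obtain ⟨Ss, hSs, hSsu⟩ := hν.existsUnique_lyapunov hs (c := 2) (by linarith)
    ((1 + A) * crossCov κ π (mdiff κ (vpoisson κ (vpoisson κ f))) (mdiff κ (vpoisson κ f))
      + crossCov κ π (mdiff κ (vpoisson κ f)) (mdiff κ (vpoisson κ (vpoisson κ f))) * (1 + A)ᵀ
      - A * Sθ * Aᵀ + Q)
  have hSθ' : IsLyapunov A Q Sθ := isLyapunov_iff.2 hSθ
  have hSs' := isLyapunovTwo_iff.2 hSs
  have hQpsd : Q.PosSemidef := hQ ▸ h.noiseCov_posSemidef hf hf0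
  refine ⟨Sθ, Ss, hν.posSemidef_of_isLyapunov hK hs hp1.le hQpsd hSθ', hSθ',
    fun S hS => hSθu S (isLyapunov_iff.1 hS), hSs', fun S hS => hSsu S (isLyapunovTwo_iff.1 hS), ?_⟩
  intro Ω _ P _ ℱ Φ z₀ x₀ hΦ
  refine ⟨fun n i j => (h.memLp_saPath hΦ hf n i).integrable_mul
    (h.memLp_saPath hΦ hf n j), ?_⟩
  subst hQ
  obtain ⟨M, hM⟩ := h.covariance_saPath_expansion (x₀ := x₀) hΦ hf hf0 hν hK hs hp1.le hp2
    hSθ' hSs'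
  refine ⟨M, fun n hn i j => ?_⟩
  have := (abs_apply_le_norm _ i j).trans (hM n hn)
  rw [one_div, inv_pow, show -(2 * p) = -2 - (2 * p - 2) by ring] at this
  exact this
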